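/- We work over $\mathbb{C}$. Let $n$ and $d_1,\dots,d_k$ be positive integers with $\sum_{j=1}^k d_j<n+1$, not all $d_j$ equal to $1$, and put $$a_j=\frac{\sum_{i=1}^k d_i+(n-k+1)d_j-(n+1)}{(n-k+1)\,d_j},\qquad 1\le j\le k .$$ For each $j$ let $S_{d_j}\subset\mathbb{P}^n$ be a hypersurface of degree $d_j$, i.e. the effective divisor $\{F_j=0\}$ of a nonzero homogeneous polynomial $F_j\in\mathbb{C}[x_0,\dots,x_n]$ of degree $d_j$; the $S_{d_j}$ need not be smooth, reduced, irreducible or distinct. Suppose that $(\mathbb{P}^n,\sum_{j=1}^k a_jS_{d_j})$ is a K-semistable log Fano pair. Then every $S_{d_j}$ is irreducible (as a divisor: it is a prime divisor, that is, $F_j$ is an irreducible polynomial), and the $S_{d_j}$ are pairwise different. Here a log pair $(X,\Delta)$ is a normal projective variety $X$ with an effective $\mathbb{Q}$-divisor $\Delta$ such that $K_X+\Delta$ is $\mathbb{Q}$-Cartier. A prime divisor $E$ over $X$ is a prime divisor on some normal variety $Y$ with a proper birational morphism $f:Y\to X$, and $A_{X,\Delta}(E)=1+\mathrm{ord}_E(K_Y-f^*(K_X+\Delta))$.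 The pair is log Fano if $A_{X,\Delta}(E)>0$ for all prime divisors $E$ over $X$ (klt) and $-(K_X+\Delta)$ is ample. A log Fano pair is K-semistable if $A_{X,\Delta}(E)\ge S_{X,\Delta}(E)$ for all prime divisors $E$ over $X$, where $$S_{X,\Delta}(E)=\frac{1}{\mathrm{vol}(-K_X-\Delta)}\int_0^\infty \mathrm{vol}\bigl(-f^*(K_X+\Delta)-tE\bigr)\,dt .$$ -/

import Mathlib

open AlgebraicGeometry CategoryTheory Order Filter MeasureTheory

noncomputable section

namespace KStab

/-! ### Complex varieties, models and prime divisors over a variety -/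

/-- The inclusion of the constants `ℂ → K(X)` for an integral scheme `X` over `Spec ℂ`. -/
def constHom (X : Scheme.{0}) [IsIntegral X] [X.Over (Spec (.of ℂ))] : ℂ →+* X.functionField :=
  ((Scheme.ΓSpecIso (.of ℂ)).inv ≫ (X ↘ Spec (.of ℂ)).appTop ≫
    X.presheaf.germ ⊤ (genericPoint X) trivial).hom

instance (X : Scheme.{0}) [IsIntegral X] [X.Over (Spec (.of ℂ))] : Algebra ℂ X.functionField :=
  (constHom X).toAlgebra

/-- A proper birational morphism `f : Y ⟶ X` from a normal variety `Y` to the variety `X`. As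
usual, `f` is birational if it maps the generic point to the generic point and induces an
isomorphism of the local rings there. -/
structure BirationalModel (X : Scheme.{0}) [IsIntegral X] where
  Y : Scheme.{0}
  f : Y ⟶ X
  isIntegral : IsIntegral Y
  isProper : IsProper f
  isNormal : ∀ y : Y, IsIntegrallyClosed (Y.presheaf.stalk y)
  map_genericPoint : f (genericPoint Y) = genericPoint X
  isIso_stalkMap : IsIso (f.stalkMap (genericPoint Y))

attribute [instance] BirationalModel.isIntegral BirationalModel.isProper

section Model

variable {X : Scheme.{0}} [IsIntegral X]

instance [IsLocallyNoetherian X] (M : BirationalModel X) : IsLocallyNoetherian M.Y :=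
  LocallyOfFiniteType.isLocallyNoetherian M.f

/-- The pull-back `f^* : K(X) → K(Y)` of rational functions (an isomorphism). -/
def BirationalModel.pullback (M : BirationalModel X) : X.functionField →+* M.Y.functionField :=
  ((X.presheaf.stalkCongr (.of_eq M.map_genericPoint.symm)).hom ≫
    M.f.stalkMap (genericPoint M.Y)).hom

end Model

/-- A prime divisor `E` over `X`: a prime divisor on some normal `Y` with a proper birational
morphism `f : Y ⟶ X`. It is given by its generic point, a point of codimension one of `Y`. -/
structure PrimeDivisorOver (X : Scheme.{0}) [IsIntegral X] extends BirationalModel X where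
  E : Y
  codim_one : coheight E = 1

/-! ### Divisors and canonical divisors

A Weil divisor is given by its coefficients, as a function on the points of the scheme of which
only the values at points of codimension one matter. The rational functions and rational forms
on all models `Y` of `X` are those of the function field `K` of `X`, which is mapped to `K(Y)`
by an isomorphism `φ`. -/

section Divisors

variable {K : Type} [Field K] [Algebra ℂ K] {Y : Scheme.{0}} [IsIntegral Y]
  (φ : K →+* Y.functionField)

/-- The local ring of `Y` at `P`, as a subring of `K`. -/
def localRing (P : Y) : Subring K :=
  (algebraMap (Y.presheaf.stalk P) Y.functionField).range.comap φ

/-- The submodule of `⋀ⁿ Ω_{K/ℂ}` of those forms that are regular at `P`: it is generated over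
the local ring of `Y` at `P` by the `d b₁ ∧ … ∧ d bₙ` with `bᵢ` in the local ring. -/
def regularForms (n : ℕ) (P : Y) : Submodule (localRing φ P) (⋀[K]^n (Ω[K⁄ℂ])) :=
  Submodule.span (localRing φ P) (Set.range fun b : Fin n → localRing φ P =>
    exteriorPower.ιMulti K n fun i => KaehlerDifferential.D ℂ K (b i : K))

variable [IsLocallyNoetherian Y]

/-- The canonical divisor `K_Y = div ω` of a rational `n`-form `ω ≠ 0`, where `n = dim Y`: its
coefficient at `P` is the largest `e` with `ω ∈ g · {forms regular at P}`, `ord_P g = e`. -/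
def canonicalDivisor (n : ℕ) (ω : ⋀[K]^n (Ω[K⁄ℂ])) (P : Y) : ℤ :=
  sSup {e : ℤ | ∃ g : K, g ≠ 0 ∧ Scheme.ord (φ g) P = e ∧ ∃ η ∈ regularForms φ n P, ω = g • η}

/-- The space of sections `H⁰(Y, ⌊D⌋)` of an `ℝ`-divisor `D`: the rational functions `g` with
`g = 0` or `div g + D ≥ 0`. (On a normal `Y` they form a subspace already.) -/
def sections (D : Y → ℝ) : Submodule ℂ K :=
  Submodule.span ℂ {g : K | g = 0 ∨ ∀ P : Y, coheight P = 1 → 0 ≤ (Scheme.ord (φ g) P : ℝ) + D P}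

/-- The volume of an `ℝ`-divisor on an `n`-dimensional `Y`:
`vol D = limsup_m h⁰(Y, ⌊mD⌋) / (mⁿ / n!)`. -/
def vol (n : ℕ) (D : Y → ℝ) : ℝ :=
  limsup (fun m : ℕ => (Module.finrank ℂ (sections φ fun P => m * D P) : ℝ) /
    ((m : ℝ) ^ n / (n.factorial : ℝ))) atTop

end Divisors

section Pairs

variable {X : Scheme.{0}} [IsIntegral X] [IsLocallyNoetherian X]

/-- `g` is a local equation of `m D` near the point `x`. -/
def IsLocalEquation (D : X → ℚ) (x : X) (m : ℕ) (g : X.functionField) : Prop :=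
  0 < m ∧ g ≠ 0 ∧ ∀ Q : X, coheight Q = 1 → Q ⤳ x → (Scheme.ord g Q : ℚ) = m * D Q

/-- `D` is a `ℚ`-Cartier divisor. -/
def IsQCartier (D : X → ℚ) : Prop :=
  ∀ x : X, ∃ m g, IsLocalEquation D x m g

open Classical in
/-- The coefficient at `P` of the pull-back `f^* D` of a `ℚ`-Cartier divisor `D`: it is
`ord_P (f^* g) / m` for a local equation `g` of some multiple `m D` near `f P`. -/
def pullbackDivisor (M : BirationalModel X) (D : X → ℚ) (P : M.Y) : ℚ :=
  if h : ∃ q : ℕ × X.functionField, IsLocalEquation D (M.f P) q.1 q.2 then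
    (Scheme.ord (M.pullback h.choose.2) P : ℚ) / h.choose.1
  else 0

/-- `D` is an ample `ℚ`-divisor: every point of `X` has an affine neighbourhood that is the
non-vanishing locus of a section of some multiple of `D`. -/
def IsAmple (D : X → ℚ) : Prop :=
  ∀ x : X, ∃ (m : ℕ) (g : X.functionField) (U : X.Opens), 0 < m ∧ g ≠ 0 ∧
    (∀ Q : X, coheight Q = 1 → 0 ≤ (Scheme.ord g Q : ℚ) + m * D Q) ∧
    IsAffineOpen U ∧ x ∈ U ∧
    ∀ y : X, y ∈ U ↔ ∀ Q : X, coheight Q = 1 → Q ⤳ y → (Scheme.ord g Q : ℚ) + m * D Q = 0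

variable [X.Over (Spec (.of ℂ))]

/-- The divisor `K_X + Δ`, where `K_X = div ω`. -/
def logCanonical (n : ℕ) (ω : ⋀[X.functionField]^n (Ω[X.functionField⁄ℂ])) (Δ : X → ℚ) : X → ℚ :=
  fun P => (canonicalDivisor (RingHom.id X.functionField) n ω P : ℚ) + Δ P

/-- The log discrepancy `A_{X,Δ}(E) = 1 + ord_E (K_Y - f^* (K_X + Δ))`, where `K_X` and `K_Y` are
the divisors of the same rational form `ω`. -/
def logDiscrepancy (n : ℕ) (ω : ⋀[X.functionField]^n (Ω[X.functionField⁄ℂ])) (Δ : X → ℚ)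
    (E : PrimeDivisorOver X) : ℚ :=
  1 + ((canonicalDivisor E.pullback n ω E.E : ℚ) -
    pullbackDivisor E.toBirationalModel (logCanonical n ω Δ) E.E)

open Classical in
/-- The invariant
`S_{X,Δ}(E) = (∫_0^∞ vol (-f^* (K_X + Δ) - t E) dt) / vol (-K_X - Δ)`. -/
def expectedVanishing (n : ℕ) (ω : ⋀[X.functionField]^n (Ω[X.functionField⁄ℂ])) (Δ : X → ℚ)
    (E : PrimeDivisorOver X) : ℝ :=
  (1 / vol (RingHom.id X.functionField) n fun Q : X => -(logCanonical n ω Δ Q : ℝ)) *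
    ∫ t in Set.Ioi (0 : ℝ), vol E.pullback n fun P : E.Y =>
      -(pullbackDivisor E.toBirationalModel (logCanonical n ω Δ) P : ℝ) -
        t * (if P = E.E then 1 else 0)

/-- `β_{X,Δ}(E) = A_{X,Δ}(E) - S_{X,Δ}(E)`. -/
def beta (n : ℕ) (ω : ⋀[X.functionField]^n (Ω[X.functionField⁄ℂ])) (Δ : X → ℚ)
    (E : PrimeDivisorOver X) : ℝ :=
  (logDiscrepancy n ω Δ E : ℝ) - expectedVanishing n ω Δ E

/-- `(X, Δ)` is a log pair of dimension `n`: `X` is a normal proper variety over `ℂ`, `Δ` is an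
effective `ℚ`-divisor, and `K_X + Δ` is `ℚ`-Cartier. -/
structure IsLogPair (n : ℕ) (Δ : X → ℚ) : Prop where
  isProper : IsProper (X ↘ Spec (.of ℂ))
  isNormal : ∀ x : X, IsIntegrallyClosed (X.presheaf.stalk x)
  finite_support : {P : X | coheight P = 1 ∧ Δ P ≠ 0}.Finite
  effective : ∀ P : X, coheight P = 1 → 0 ≤ Δ P
  isQCartier : ∀ ω : ⋀[X.functionField]^n (Ω[X.functionField⁄ℂ]), ω ≠ 0 →
    IsQCartier (logCanonical n ω Δ)

/-- A log pair `(X, Δ)` is log Fano if it is klt and `-(K_X + Δ)` is ample (so that `X` is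
projective). -/
structure IsLogFano (n : ℕ) (Δ : X → ℚ) : Prop extends IsLogPair n Δ where
  klt : ∀ ω : ⋀[X.functionField]^n (Ω[X.functionField⁄ℂ]), ω ≠ 0 →
    ∀ E : PrimeDivisorOver X, 0 < logDiscrepancy n ω Δ E
  ample : ∀ ω : ⋀[X.functionField]^n (Ω[X.functionField⁄ℂ]), ω ≠ 0 →
    IsAmple fun P => -logCanonical n ω Δ P

/-- `(X, Δ)` is a K-semistable log Fano pair: `β_{X,Δ}(E) ≥ 0` for all prime divisors `E` over
`X`. Here `K_X` is the divisor of any rational form `ω ≠ 0`. -/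
structure IsKSemistableLogFano (n : ℕ) (Δ : X → ℚ) : Prop extends IsLogFano n Δ where
  beta_nonneg : ∀ ω : ⋀[X.functionField]^n (Ω[X.functionField⁄ℂ]), ω ≠ 0 →
    ∀ E : PrimeDivisorOver X, 0 ≤ beta n ω Δ E

end Pairs

/-! ### Projective space and its hypersurfaces -/

instance (n : ℕ) : GradedAlgebra (MvPolynomial.homogeneousSubmodule (Fin (n + 1)) ℂ) :=
  MvPolynomial.gradedAlgebra

/-- Complex projective space `ℙⁿ = Proj ℂ[x₀, …, xₙ]`. -/
abbrev PSpace (n : ℕ) : Scheme.{0} := Proj (MvPolynomial.homogeneousSubmodule (Fin (n + 1)) ℂ)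

instance (n : ℕ) : (PSpace n).Over (Spec (.of ℂ)) where
  hom := Proj.toSpecZero _ ≫ Spec.map (CommRingCat.ofHom
    (algebraMap ℂ (MvPolynomial.homogeneousSubmodule (Fin (n + 1)) ℂ 0)))

/-- The point of `ℙⁿ` given by the zero ideal. -/
def zeroPoint (n : ℕ) :
    ProjectiveSpectrum (MvPolynomial.homogeneousSubmodule (Fin (n + 1)) ℂ) where
  asHomogeneousIdeal := ⊥
  isPrime := by
    rw [HomogeneousIdeal.toIdeal_bot]
    exact Ideal.isPrime_bot
  not_irrelevant_le := by
    intro h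
    have hX : (MvPolynomial.X 0 : MvPolynomial (Fin (n + 1)) ℂ) ∈
        HomogeneousIdeal.irrelevant (MvPolynomial.homogeneousSubmodule (Fin (n + 1)) ℂ) := by
      rw [HomogeneousIdeal.mem_irrelevant_iff, GradedRing.proj_apply,
        DirectSum.decompose_of_mem_ne _ (i := 1) _ one_ne_zero]
      exact MvPolynomial.isHomogeneous_X ℂ 0
    have h0 := h hX
    rw [← HomogeneousIdeal.mem_iff, HomogeneousIdeal.toIdeal_bot, Ideal.mem_bot] at h0
    exact MvPolynomial.X_ne_zero 0 h0

instance (n : ℕ) : IsIntegral (PSpace n) := by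
  have hz : ∀ y : ProjectiveSpectrum (MvPolynomial.homogeneousSubmodule (Fin (n + 1)) ℂ),
      y ∈ closure {zeroPoint n} := fun y => by
    rw [← ProjectiveSpectrum.le_iff_mem_closure, ← ProjectiveSpectrum.as_ideal_le_as_ideal]
    exact bot_le
  have hirr : IrreducibleSpace
      (ProjectiveSpectrum (MvPolynomial.homogeneousSubmodule (Fin (n + 1)) ℂ)) := by
    rw [irreducibleSpace_def, Set.top_eq_univ, ← Set.univ_subset_iff.mp fun y _ => hz y]
    exact isIrreducible_singleton.closure
  have : IrreducibleSpace (PSpace n) := hirr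
  have (x : PSpace n) : _root_.IsReduced ((PSpace n).presheaf.stalk x) := by
    let e := (Proj.stalkIso (MvPolynomial.homogeneousSubmodule (Fin (n + 1)) ℂ)
      x).commRingCatIsoToRingEquiv
    have hp : x.asHomogeneousIdeal.toIdeal.IsPrime := ProjectiveSpectrum.isPrime x
    have hd : IsDomain (Localization
        x.asHomogeneousIdeal.toIdeal.primeCompl) :=
      IsLocalization.isDomain_localization (Ideal.primeCompl_le_nonZeroDivisors _)
    have hr : _root_.IsReduced (HomogeneousLocalization.AtPrime
        (MvPolynomial.homogeneousSubmodule (Fin (n + 1)) ℂ) x.asHomogeneousIdeal.toIdeal) :=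
      isReduced_of_injective (algebraMap _ (Localization
        x.asHomogeneousIdeal.toIdeal.primeCompl)) (HomogeneousLocalization.val_injective _)
    exact isReduced_of_injective e e.injective
  have : IsReduced (PSpace n) := isReduced_of_isReduced_stalk _
  exact isIntegral_of_irreducibleSpace_of_isReduced _

instance (n : ℕ) : IsLocallyNoetherian (PSpace n) := by
  have : IsScalarTower ℂ (MvPolynomial.homogeneousSubmodule (Fin (n + 1)) ℂ 0)
      (MvPolynomial (Fin (n + 1)) ℂ) := 
    ⟨fun a b c => smul_mul_assoc a (b : MvPolynomial (Fin (n + 1)) ℂ) c⟩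
  have : Algebra.FiniteType (MvPolynomial.homogeneousSubmodule (Fin (n + 1)) ℂ 0)
      (MvPolynomial (Fin (n + 1)) ℂ) :=
    Algebra.FiniteType.of_restrictScalars_finiteType ℂ _ _
  have hs : Function.Surjective
      (algebraMap ℂ (MvPolynomial.homogeneousSubmodule (Fin (n + 1)) ℂ 0)) := by
    rintro ⟨p, hp⟩
    refine ⟨p.coeff 0, Subtype.ext ?_⟩
    exact (MvPolynomial.totalDegree_eq_zero_iff_eq_C.mp
      ((MvPolynomial.totalDegree_zero_iff_isHomogeneous _).mpr hp)).symm
  have : IsNoetherianRing (MvPolynomial.homogeneousSubmodule (Fin (n + 1)) ℂ 0) :=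
    isNoetherianRing_of_surjective _ _ _ hs
  exact LocallyOfFiniteType.isLocallyNoetherian
    (Proj.toSpecZero (MvPolynomial.homogeneousSubmodule (Fin (n + 1)) ℂ))

/-- A hypersurface of degree `d` in `ℙⁿ`, given by its equation. -/
structure Hypersurface (n d : ℕ) where
  eqn : MvPolynomial (Fin (n + 1)) ℂ
  isHomogeneous : eqn.IsHomogeneous d
  ne_zero : eqn ≠ 0

namespace Hypersurface

variable {n d : ℕ} (S : Hypersurface n d)

/-- The local equation `F / x_i ^ d` of `S = {F = 0}` at a point `P` with `x_i ≠ 0`. -/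
def localEqn (P : PSpace n) (i : Fin (n + 1))
    (hi : MvPolynomial.X i ∉ P.asHomogeneousIdeal.toIdeal) : (PSpace n).presheaf.stalk P :=
  (Proj.stalkIso (MvPolynomial.homogeneousSubmodule (Fin (n + 1)) ℂ) P).inv.hom
    (HomogeneousLocalization.mk
      { deg := d
        num := ⟨S.eqn, S.isHomogeneous⟩
        den := ⟨MvPolynomial.X i ^ d, by
          simpa using (MvPolynomial.isHomogeneous_X ℂ i).pow d⟩
        den_mem := Submonoid.pow_mem _ (by simpa [Ideal.primeCompl] using hi) d })

open Classical in
/-- The divisor of the hypersurface `S`: its coefficient at `P` is the order at `P` of a local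
equation of `S`. -/
def divisor (P : PSpace n) : ℤ :=
  if h : ∃ i : Fin (n + 1), MvPolynomial.X i ∉ P.asHomogeneousIdeal.toIdeal then
    Scheme.ord (algebraMap ((PSpace n).presheaf.stalk P) (PSpace n).functionField
      (S.localEqn P h.choose h.choose_spec)) P
  else 0

/-- The set of points of the hypersurface `S`. -/
def carrier : Set (PSpace n) :=
  ProjectiveSpectrum.zeroLocus (MvPolynomial.homogeneousSubmodule (Fin (n + 1)) ℂ) {S.eqn}

end Hypersurface

/-- The coefficient `a_j`. -/
def coeff (n : ℕ) {k : ℕ} (d : Fin k → ℕ) (j : Fin k) : ℚ :=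
  ((∑ i, (d i : ℚ)) + ((n : ℚ) - k + 1) * d j - (n + 1)) / (((n : ℚ) - k + 1) * d j)

end KStab

end

noncomputable section

namespace KStab

/-! K-semistability is tested only on prime divisors lying on `ℙⁿ` itself, namely `E = {G = 0}` with
`G` an irreducible form of degree `e`. Put `s = (n + 1 - ∑ dᵢ) / (n - k + 1)`, so that `aⱼ = 1 - s /
dⱼ`. Then `∑ aⱼ dⱼ = ∑ dⱼ - k s`, and `-(K + Δ)` has degree `n + 1 - ∑ aⱼ dⱼ = (n + 1) s`. A divisor
of degree `δ` has volume `max(δ, 0)ⁿ`, so integrating `max((n + 1) s - t e, 0)ⁿ` gives `S(E) = s /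
e`, while `A(E) = 1 - ∑ aⱼ mult_G(Fⱼ)`. Hence `∑ aⱼ mult_G(Fⱼ) ≤ 1 - s / e` for every `G`
(`sum_coeff_mul_multiplicity_le`).

Since `0 < s < 1`, all `aⱼ` are positive. If `G` divides `Fⱼ`, then `1 - s / dⱼ = aⱼ ≤ 1 - s / e`,
so `dⱼ ≤ e` and `Fⱼ` is a constant times `G`. If `Fⱼ` divides `Fᵢ` for some `i ≠ j`, the choice `G =
Fⱼ` gives `aᵢ + aⱼ ≤ 1 - s / dⱼ = aⱼ`, contradicting `aᵢ > 0`.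

The bulk of the work makes the invariants of `ℙⁿ` explicit: orders are differences of multiplicities
(`ord_primePoint`), `K = -(n + 1) {x₀ = 0}` (`canonicalDivisor_chartForm_zero`), and volumes come
from counting forms (`vol_eq`). -/

/-! ### Rational functions on `ℙⁿ` as fractions of forms -/

/-- The homogeneous coordinate ring of `ℙⁿ`. -/
abbrev CoordRing (n : ℕ) : Type := MvPolynomial (Fin (n + 1)) ℂ

/-- The fraction field of the homogeneous coordinate ring. -/
abbrev CoordField (n : ℕ) : Type := FractionRing (CoordRing n)

/-- The grading of the homogeneous coordinate ring. -/
abbrev grading (n : ℕ) : ℕ → Submodule ℂ (CoordRing n) :=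
  MvPolynomial.homogeneousSubmodule (Fin (n + 1)) ℂ

/-- The degree zero part of the local ring of the cone, as fractions of polynomials. -/
def fracAt {n : ℕ} (I : Ideal (CoordRing n)) [I.IsPrime] :
    HomogeneousLocalization.AtPrime (grading n) I →+* CoordField n :=
  (IsLocalization.lift (M := I.primeCompl) (S := Localization I.primeCompl)
    (g := algebraMap (CoordRing n) (CoordField n)) fun y =>
      IsUnit.mk0 _ (by
        rw [Ne, FaithfulSMul.algebraMap_eq_zero_iff]
        rintro h
        exact y.2 (h ▸ I.zero_mem))).comp
    (algebraMap (HomogeneousLocalization.AtPrime (grading n) I) (Localization I.primeCompl))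

theorem fracAt_mk {n : ℕ} (I : Ideal (CoordRing n)) [I.IsPrime]
    (c : HomogeneousLocalization.NumDenSameDeg (grading n) I.primeCompl) :
    fracAt I (HomogeneousLocalization.mk c) =
      algebraMap _ (CoordField n) (c.num : CoordRing n) / algebraMap _ _ (c.den : CoordRing n) := by
  have h0 : algebraMap (CoordRing n) (CoordField n) (c.den : CoordRing n) ≠ 0 := by
    rw [Ne, FaithfulSMul.algebraMap_eq_zero_iff]
    intro h
    exact c.den_mem (h ▸ I.zero_mem)
  rw [fracAt, RingHom.comp_apply, HomogeneousLocalization.algebraMap_apply,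
    HomogeneousLocalization.val_mk, Localization.mk_eq_mk', IsLocalization.lift_mk'_spec]
  exact (mul_div_cancel₀ _ h0).symm

instance {n : ℕ} (P : PSpace n) : P.asHomogeneousIdeal.toIdeal.IsPrime :=
  ProjectiveSpectrum.isPrime P

/-- A rational function on `ℙⁿ` as a fraction of polynomials. -/
def toFrac (n : ℕ) : (PSpace n).functionField →+* CoordField n :=
  (fracAt (genericPoint (PSpace n)).asHomogeneousIdeal.toIdeal).comp
    (Proj.stalkIso (grading n) (genericPoint (PSpace n))).hom.hom

theorem toFrac_injective (n : ℕ) : Function.Injective (toFrac n) := (toFrac n).injective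

/-- The element of the stalk at `P` given by the fraction of two forms. -/
def stalkFrac {n : ℕ} (P : PSpace n)
    (c : HomogeneousLocalization.NumDenSameDeg (grading n)
      P.asHomogeneousIdeal.toIdeal.primeCompl) : (PSpace n).presheaf.stalk P :=
  (Proj.stalkIso (grading n) P).inv.hom (HomogeneousLocalization.mk c)

theorem stalkFrac_surjective {n : ℕ} (P : PSpace n) : Function.Surjective (stalkFrac P) := by
  intro x
  obtain ⟨c, hc⟩ := HomogeneousLocalization.mk_surjective
    ((Proj.stalkIso (grading n) P).hom.hom x)
  refine ⟨c, ?_⟩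
  rw [stalkFrac, hc]
  simp

/-- The fraction is a section over the basic open set of its denominator. This set contains the
generic point, so the germs at `P` and at the generic point come from the same fraction. -/
theorem toFrac_stalkFrac {n : ℕ} (P : PSpace n)
    (c : HomogeneousLocalization.NumDenSameDeg (grading n)
      P.asHomogeneousIdeal.toIdeal.primeCompl) :
    toFrac n (algebraMap _ (PSpace n).functionField (stalkFrac P c)) =
      algebraMap _ (CoordField n) (c.num : CoordRing n) / algebraMap _ _ (c.den : CoordRing n) := by
  have hx : P ∈ ProjectiveSpectrum.basicOpen (grading n) (c.den : CoordRing n) := c.den_mem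
  have hg : genericPoint (PSpace n) ∈
      ProjectiveSpectrum.basicOpen (grading n) (c.den : CoordRing n) :=
    ((genericPoint_spec (PSpace n)).specializes trivial).mem_open
      (ProjectiveSpectrum.basicOpen (grading n) (c.den : CoordRing n)).isOpen hx
  have h1 : (Proj.stalkIso (grading n) (genericPoint (PSpace n))).hom.hom
      (algebraMap _ (PSpace n).functionField (stalkFrac P c)) =
      HomogeneousLocalization.mk ⟨c.deg, c.num, c.den, hg⟩ := by
    rw [stalkFrac]
    change (Proj.stalkIso' (grading n) _) (_) = _
    have h2 : (algebraMap _ (PSpace n).functionField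
        ((Proj.stalkIso (grading n) P).inv.hom (HomogeneousLocalization.mk c))) =
        (PSpace n).presheaf.germ _ _ hg (sectionInBasicOpen _ P c) := by
      change algebraMap _ (PSpace n).functionField ((PSpace n).presheaf.germ _ P hx
        (sectionInBasicOpen _ P c)) = _
      have : Nonempty (Proj.basicOpen (grading n) (c.den : CoordRing n)) := ⟨P, hx⟩
      exact Scheme.algebraMap_germ_eq_germToFunctionField (PSpace n)
        (U := Proj.basicOpen (grading n) (c.den : CoordRing n)) hx _
    rw [h2]
    exact Proj.stalkIso'_germ ..
  rw [toFrac, RingHom.comp_apply, h1, fracAt_mk]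

/-- Needed to trace constants through the structure morphism in `toFrac_const`. `Proj.toSpecZero` is
built from the affine chart of the element 1, whose basic open set is all of `ℙⁿ`, so the
computation takes place there. -/
theorem toSpecZero_appTop_germ (n : ℕ) (P : PSpace n) :
    (Scheme.ΓSpecIso _).inv ≫ (Proj.toSpecZero (grading n)).appTop ≫
      (PSpace n).presheaf.germ ⊤ P trivial =
    CommRingCat.ofHom (HomogeneousLocalization.fromZeroRingHom (grading n) _) ≫
      Proj.awayToSection (grading n) 1 ≫
      (PSpace n).presheaf.germ (Proj.basicOpen (grading n) 1) P
        (by rw [Proj.basicOpen_one]; trivial) := by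
  have h1 : (Proj.basicOpen (grading n) 1).ι ≫ Proj.toSpecZero (grading n) =
      Proj.basicOpenToSpec (grading n) 1 ≫
        Spec.map (CommRingCat.ofHom (HomogeneousLocalization.fromZeroRingHom _ _)) := by
    rw [Proj.toSpecZero, ← Category.assoc, ← Category.assoc, ← Category.assoc]
    have : (((Proj.basicOpen (grading n) 1).ι ≫ (Scheme.topIso (PSpace n)).inv) ≫
      ((PSpace n).isoOfEq (Proj.basicOpen_one _)).inv) = 𝟙 _ := by
      rw [← cancel_mono (Proj.basicOpen (grading n) 1).ι]
      simp
    rw [this, Category.id_comp]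
  have hP : P ∈ Proj.basicOpen (grading n) 1 := by rw [Proj.basicOpen_one]; trivial
  have h2 : (PSpace n).presheaf.germ ⊤ P trivial = (Proj.basicOpen (grading n) 1).ι.appTop ≫
      (Proj.basicOpen (grading n) 1).topIso.hom ≫
      (PSpace n).presheaf.germ (Proj.basicOpen (grading n) 1) P hP := by
    have : (Proj.basicOpen (grading n) 1).ι.appTop ≫ (Proj.basicOpen (grading n) 1).topIso.hom =
        (PSpace n).presheaf.map (homOfLE le_top).op := by
      simp
      rfl
    rw [← Category.assoc, this, TopCat.Presheaf.germ_res]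
  have h3 := congrArg Scheme.Hom.appTop h1
  rw [Scheme.Hom.comp_appTop, Scheme.Hom.comp_appTop] at h3
  rw [h2, reassoc_of% h3]
  change _ ≫ _ ≫ (Proj.basicOpenToSpec (grading n) 1).app ⊤ ≫ _ = _
  rw [Proj.basicOpenToSpec_app_top]
  simp [-Scheme.Opens.topIso_hom, -Scheme.Opens.topIso_inv]

theorem toFrac_const (n : ℕ) (c : ℂ) :
    toFrac n (algebraMap ℂ (PSpace n).functionField c) =
      algebraMap (CoordRing n) (CoordField n) (MvPolynomial.C c) := by
  have h : (PSpace n ↘ Spec (.of ℂ)) = Proj.toSpecZero (grading n) ≫ Spec.map (CommRingCat.ofHom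
    (algebraMap ℂ (grading n 0))) := rfl
  have h1 : (Scheme.ΓSpecIso (.of ℂ)).inv ≫ (PSpace n ↘ Spec (.of ℂ)).appTop ≫
      (PSpace n).presheaf.germ ⊤ (genericPoint (PSpace n)) trivial =
      CommRingCat.ofHom (algebraMap ℂ (grading n 0)) ≫
      CommRingCat.ofHom (HomogeneousLocalization.fromZeroRingHom (grading n) _) ≫
      Proj.awayToSection (grading n) 1 ≫
      (PSpace n).presheaf.germ (Proj.basicOpen (grading n) 1) (genericPoint (PSpace n))
        (by rw [Proj.basicOpen_one]; trivial) := by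
    rw [← toSpecZero_appTop_germ, h, Scheme.Hom.comp_appTop,
      Scheme.ΓSpecIso_inv_naturality_assoc]
    simp
  have h2 := ProjectiveSpectrum.Proj.awayToSection_germ (grading n) 1 (genericPoint (PSpace n))
    (by rw [ProjectiveSpectrum.basicOpen_one]; trivial)
  rw [RingHom.algebraMap_toAlgebra, constHom, h1]
  change fracAt _ (Proj.stalkIso' (grading n) (genericPoint (PSpace n)) ((CommRingCat.Hom.hom
    (ProjectiveSpectrum.Proj.awayToSection (grading n) 1 ≫ _))
      (HomogeneousLocalization.mk ⟨0, algebraMap ℂ (grading n 0) c, 1, _⟩))) = _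
  erw [h2]
  change fracAt _ (Proj.stalkIso' (grading n) (genericPoint (PSpace n))
    ((Proj.stalkIso' (grading n) (genericPoint (PSpace n))).symm
      (HomogeneousLocalization.mk ⟨0, algebraMap ℂ (grading n 0) c, 1, _⟩))) = _
  rw [RingEquiv.apply_symm_apply, fracAt_mk]
  simp

theorem specializes_iff {n : ℕ} (P Q : PSpace n) :
    P ⤳ Q ↔ P.asHomogeneousIdeal.toIdeal ≤ Q.asHomogeneousIdeal.toIdeal := by
  rw [specializes_iff_mem_closure]
  exact (ProjectiveSpectrum.le_iff_mem_closure (𝒜 := grading n) P Q).symm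

theorem genericPoint_ideal (n : ℕ) :
    (genericPoint (PSpace n)).asHomogeneousIdeal.toIdeal = ⊥ := by
  have h : genericPoint (PSpace n) ⤳ (zeroPoint n : PSpace n) :=
    (genericPoint_spec (PSpace n)).specializes trivial
  exact le_bot_iff.mp (((specializes_iff _ (show PSpace n from zeroPoint n)).mp h).trans (HomogeneousIdeal.toIdeal_bot (𝒜 := grading n)).le)

/-- The rational function `a / b` is given by forms of the same degree with `b` not vanishing
at `P`. -/
theorem mem_localRing_iff {n : ℕ} (P : PSpace n) (g : (PSpace n).functionField) :
    g ∈ localRing (RingHom.id (PSpace n).functionField) P ↔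
      ∃ (N : ℕ) (a b : CoordRing n), a.IsHomogeneous N ∧ b.IsHomogeneous N ∧
        b ∉ P.asHomogeneousIdeal.toIdeal ∧
        toFrac n g = algebraMap _ (CoordField n) a / algebraMap _ _ b := by
  constructor
  · rintro ⟨x, hx⟩
    obtain ⟨c, rfl⟩ := stalkFrac_surjective P x
    refine ⟨c.deg, c.num, c.den, c.num.2, c.den.2, c.den_mem, ?_⟩
    rw [← toFrac_stalkFrac, hx]
    rfl
  · rintro ⟨N, a, b, ha, hb, hP, h⟩
    refine ⟨stalkFrac P ⟨N, ⟨a, ha⟩, ⟨b, hb⟩, hP⟩, toFrac_injective n ?_⟩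
    rw [toFrac_stalkFrac]
    exact h.symm

/-- The function field is the local ring at the generic point, whose ideal is zero, so non-vanishing
of the denominator there only means `b ≠ 0`. -/
theorem exists_toFrac_eq {n : ℕ} (g : (PSpace n).functionField) :
    ∃ (N : ℕ) (a b : CoordRing n), a.IsHomogeneous N ∧ b.IsHomogeneous N ∧ b ≠ 0 ∧
      toFrac n g = algebraMap _ (CoordField n) a / algebraMap _ _ b := by
  have h : g ∈ localRing (RingHom.id (PSpace n).functionField) (genericPoint (PSpace n)) := by
    refine ⟨g, ?_⟩
    change ((PSpace n).presheaf.stalkSpecializes _).hom g = g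
    rw [TopCat.Presheaf.stalkSpecializes_refl]
    rfl
  obtain ⟨N, a, b, ha, hb, hP, h⟩ := (mem_localRing_iff _ g).mp h
  refine ⟨N, a, b, ha, hb, ?_, h⟩
  rw [genericPoint_ideal] at hP
  exact hP

theorem exists_toFrac_eq_div {n N : ℕ} {a b : CoordRing n} (ha : a.IsHomogeneous N)
    (hb : b.IsHomogeneous N) (h0 : b ≠ 0) :
    ∃ g, toFrac n g = algebraMap _ (CoordField n) a / algebraMap _ _ b := by
  have hP : b ∉ (genericPoint (PSpace n)).asHomogeneousIdeal.toIdeal := by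
    rw [genericPoint_ideal]
    exact h0
  exact ⟨_, toFrac_stalkFrac (genericPoint (PSpace n)) ⟨N, ⟨a, ha⟩, ⟨b, hb⟩, hP⟩⟩

/-! ### Factors and divisibility of forms -/

section Homogeneous

variable {σ : Type*}

/-- The substitution `xᵢ ↦ xᵢ T`, which separates the homogeneous components. -/
def scaleVars (σ : Type*) : MvPolynomial σ ℂ →ₐ[ℂ] Polynomial (MvPolynomial σ ℂ) :=
  MvPolynomial.aeval fun i => Polynomial.C (MvPolynomial.X i) * Polynomial.X

theorem scaleVars_monomial (s : σ →₀ ℕ) (r : ℂ) :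
    scaleVars σ (MvPolynomial.monomial s r) =
      Polynomial.C (MvPolynomial.monomial s r) * Polynomial.X ^ s.degree := by
  rw [scaleVars, MvPolynomial.aeval_monomial, MvPolynomial.monomial_eq]
  simp only [mul_pow, Finsupp.prod, Finset.prod_mul_distrib, Finset.prod_pow_eq_pow_sum,
    map_mul, map_prod, map_pow, Finsupp.degree_apply]
  rw [mul_assoc]
  rfl

theorem coeff_scaleVars (p : MvPolynomial σ ℂ) (d : ℕ) :
    (scaleVars σ p).coeff d = MvPolynomial.homogeneousComponent d p := by
  induction p using MvPolynomial.induction_on' with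
  | monomial s r =>
    rw [scaleVars_monomial, Polynomial.coeff_C_mul_X_pow, MvPolynomial.homogeneousComponent_of_mem
      (MvPolynomial.isHomogeneous_monomial r rfl)]
  | add p q hp hq => simp [hp, hq]

theorem scaleVars_injective : Function.Injective (scaleVars σ) := by
  refine (injective_iff_map_eq_zero _).mpr fun p hp => ?_
  rw [← MvPolynomial.sum_homogeneousComponent p]
  exact Finset.sum_eq_zero fun d _ => by rw [← coeff_scaleVars, hp, Polynomial.coeff_zero]

theorem scaleVars_of_isHomogeneous {p : MvPolynomial σ ℂ} {d : ℕ} (hp : p.IsHomogeneous d) :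
    scaleVars σ p = Polynomial.monomial d p := by
  ext1 k
  rw [coeff_scaleVars, Polynomial.coeff_monomial, MvPolynomial.homogeneousComponent_of_mem hp]
  simp only [eq_comm]

/-- A factor of a homogeneous polynomial is homogeneous. -/
theorem exists_isHomogeneous_of_mul {a b : MvPolynomial σ ℂ} {N : ℕ}
    (h : (a * b).IsHomogeneous N) (h0 : a * b ≠ 0) :
    ∃ i j, i + j = N ∧ a.IsHomogeneous i ∧ b.IsHomogeneous j := by
  have ha : scaleVars σ a ≠ 0 := (map_ne_zero_iff _ scaleVars_injective).mpr (left_ne_zero_of_mul h0)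
  have hb : scaleVars σ b ≠ 0 :=
    (map_ne_zero_iff _ scaleVars_injective).mpr (right_ne_zero_of_mul h0)
  -- A form becomes a monomial in `T`. Degree and trailing degree in `T` are additive and agree on
  -- the product, hence on each factor, which therefore has a single homogeneous component.
  have hm := scaleVars_of_isHomogeneous h
  rw [map_mul] at hm
  have h1 := Polynomial.natDegree_mul ha hb
  have h2 := Polynomial.natTrailingDegree_mul ha hb
  rw [hm, Polynomial.natDegree_monomial_eq _ h0] at h1
  rw [hm, Polynomial.natTrailingDegree_monomial h0] at h2
  have h3 := Polynomial.natTrailingDegree_le_natDegree (scaleVars σ a)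
  have h4 := Polynomial.natTrailingDegree_le_natDegree (scaleVars σ b)
  have key : ∀ p : MvPolynomial σ ℂ, (scaleVars σ p).natTrailingDegree =
      (scaleVars σ p).natDegree → p.IsHomogeneous (scaleVars σ p).natDegree := by
    intro p hp
    rw [← MvPolynomial.sum_homogeneousComponent p]
    refine MvPolynomial.IsHomogeneous.sum _ _ _ fun d _ => ?_
    rcases lt_trichotomy d (scaleVars σ p).natDegree with hd | hd | hd
    · rw [← coeff_scaleVars, Polynomial.coeff_eq_zero_of_lt_natTrailingDegree (hp ▸ hd)]
      exact MvPolynomial.isHomogeneous_zero _ _ _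
    · rw [MvPolynomial.sum_homogeneousComponent, ← hd]
      exact MvPolynomial.homogeneousComponent_isHomogeneous _ _
    · rw [← coeff_scaleVars, Polynomial.coeff_eq_zero_of_natDegree_lt hd]
      exact MvPolynomial.isHomogeneous_zero _ _ _
  exact ⟨_, _, h1.symm, key a (by omega), key b (by omega)⟩

theorem exists_isHomogeneous_of_dvd {a b : MvPolynomial σ ℂ} {N : ℕ}
    (h : b.IsHomogeneous N) (h0 : b ≠ 0) (hab : a ∣ b) : ∃ i ≤ N, a.IsHomogeneous i := by
  obtain ⟨c, rfl⟩ := hab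
  obtain ⟨i, j, hij, ha, -⟩ := exists_isHomogeneous_of_mul h h0
  exact ⟨i, by omega, ha⟩

theorem finiteMultiplicity_of_irreducible {G a : MvPolynomial σ ℂ} (hG : Irreducible G)
    (ha : a ≠ 0) : FiniteMultiplicity G a :=
  .of_prime_left hG.prime ha

theorem multiplicity_mul_of_irreducible {G a b : MvPolynomial σ ℂ} (hG : Irreducible G)
    (ha : a ≠ 0) (hb : b ≠ 0) :
    multiplicity G (a * b) = multiplicity G a + multiplicity G b :=
  multiplicity_mul hG.prime (finiteMultiplicity_of_irreducible hG (mul_ne_zero ha hb))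

/-- Divisibility of forms can be tested at the irreducible forms. -/
theorem dvd_of_forall_multiplicity_le {b : MvPolynomial σ ℂ} (hb0 : b ≠ 0) :
    ∀ {a : MvPolynomial σ ℂ} {M N : ℕ}, a ≠ 0 → a.IsHomogeneous M → b.IsHomogeneous N →
    (∀ (H : MvPolynomial σ ℂ) (e : ℕ), Irreducible H → H.IsHomogeneous e →
      multiplicity H b ≤ multiplicity H a) → b ∣ a := by
  induction b using UniqueFactorizationMonoid.induction_on_prime with
  | h₁ => exact absurd rfl hb0
  | h₂ x hx => exact fun _ _ _ _ => hx.dvd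
  | h₃ b p hb hp ih =>
    intro a M N ha0 ha hbp h
    obtain ⟨e, N', -, hpe, hb'⟩ := exists_isHomogeneous_of_mul hbp hb0
    -- The hypothesis at `H = p` makes the multiplicity of `p` in `a` positive; the factor `p` is
    -- then cancelled on both sides.
    have h1 : p ∣ a := by
      apply dvd_of_multiplicity_pos
      refine lt_of_lt_of_le ?_ (h p e hp.irreducible hpe)
      rw [multiplicity_mul_of_irreducible hp.irreducible hp.ne_zero hb, multiplicity_self]
      omega
    obtain ⟨a, rfl⟩ := h1
    obtain ⟨_, M', -, -, ha'⟩ := exists_isHomogeneous_of_mul ha ha0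
    refine mul_dvd_mul_left p (ih hb (right_ne_zero_of_mul ha0) ha' hb' fun H e hH he => ?_)
    have h2 := h H e hH he
    rw [multiplicity_mul_of_irreducible hH hp.ne_zero hb,
      multiplicity_mul_of_irreducible hH hp.ne_zero (right_ne_zero_of_mul ha0)] at h2
    omega

end Homogeneous

/-! ### Points of codimension one -/

theorem point_ext {n : ℕ} {P Q : PSpace n}
    (h : P.asHomogeneousIdeal.toIdeal = Q.asHomogeneousIdeal.toIdeal) : P = Q :=
  ProjectiveSpectrum.ext (HomogeneousIdeal.toIdeal_injective h)

theorem le_iff_ideal {n : ℕ} (P Q : PSpace n) :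
    P ≤ Q ↔ Q.asHomogeneousIdeal.toIdeal ≤ P.asHomogeneousIdeal.toIdeal :=
  Scheme.le_iff_specializes.trans (specializes_iff _ _)

theorem lt_iff_ideal {n : ℕ} (P Q : PSpace n) :
    P < Q ↔ Q.asHomogeneousIdeal.toIdeal < P.asHomogeneousIdeal.toIdeal := by
  rw [lt_iff_le_not_ge, lt_iff_le_not_ge, le_iff_ideal, le_iff_ideal]

/-- A nonzero homogeneous component of an element of the ideal lies in the ideal; by primality so
does one of its prime factors, and a factor of a form is a form. -/
theorem exists_irreducible_mem {n : ℕ} (P : PSpace n)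
    (hP : P.asHomogeneousIdeal.toIdeal ≠ ⊥) :
    ∃ (G : CoordRing n) (e : ℕ), Irreducible G ∧ G.IsHomogeneous e ∧
      G ∈ P.asHomogeneousIdeal.toIdeal := by
  obtain ⟨f, hf, hf0⟩ := Submodule.exists_mem_ne_zero_of_ne_bot hP
  obtain ⟨d, hd⟩ : ∃ d, MvPolynomial.homogeneousComponent d f ≠ 0 := by
    by_contra! h
    refine hf0 ?_
    rw [← MvPolynomial.sum_homogeneousComponent f]
    exact Finset.sum_eq_zero fun d _ => h d
  have hm : MvPolynomial.homogeneousComponent d f ∈ P.asHomogeneousIdeal.toIdeal :=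
    MvPolynomial.homogeneousComponent_mem_of_mem P.asHomogeneousIdeal.isHomogeneous hf d
  obtain ⟨s, hs, u, hu⟩ := UniqueFactorizationMonoid.exists_prime_factors _ hd
  have h1 : s.prod ∈ P.asHomogeneousIdeal.toIdeal := by
    rw [← hu] at hm
    exact (Ideal.IsPrime.mem_or_mem inferInstance hm).resolve_right fun h =>
      (ProjectiveSpectrum.isPrime P).ne_top (Ideal.eq_top_of_isUnit_mem _ h u.isUnit)
  obtain ⟨G, hG, hGP⟩ := (Ideal.IsPrime.multiset_prod_mem_iff_exists_mem inferInstance s).mp h1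
  obtain ⟨e, -, he⟩ := exists_isHomogeneous_of_dvd
    (MvPolynomial.homogeneousComponent_isHomogeneous d f) hd
    ((Multiset.dvd_prod hG).trans ⟨_, hu.symm⟩)
  exact ⟨G, e, (hs G hG).irreducible, he, hGP⟩

/-- The generic point of the hypersurface `{G = 0}`. -/
def primePoint {n : ℕ} (hn : 0 < n) {G : CoordRing n} (hG : Irreducible G) {e : ℕ}
    (he : G.IsHomogeneous e) : PSpace n where
  asHomogeneousIdeal := ⟨Ideal.span {G}, Ideal.homogeneous_span _ _ (by
    rintro _ rfl
    exact ⟨e, he⟩)⟩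
  isPrime := (Ideal.span_singleton_prime hG.ne_zero).mpr hG.prime
  not_irrelevant_le := by
    intro h
    -- If the irrelevant ideal were contained in `(G)`, all variables would be associated to `G`. As
    -- `n > 0`, the first and the last variable are different, which is impossible.
    have hX : ∀ i : Fin (n + 1), G ∣ MvPolynomial.X i := by
      intro i
      rw [← Ideal.mem_span_singleton]
      refine h ?_
      rw [HomogeneousIdeal.mem_irrelevant_iff, GradedRing.proj_apply,
        DirectSum.decompose_of_mem_ne _ (i := 1) _ one_ne_zero]
      exact MvPolynomial.isHomogeneous_X ℂ i
    have h01 : (0 : Fin (n + 1)) ≠ Fin.last n := by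
      intro h
      have := congrArg Fin.val h
      simp at this
      omega
    have hX1 := fun i => (hG.dvd_irreducible_iff_associated (MvPolynomial.X_prime (i := i)).irreducible).mp
      (hX i)
    have h2 : (MvPolynomial.X 0 : CoordRing n) ∣ MvPolynomial.X (Fin.last n) :=
      ((hX1 0).symm.trans (hX1 (Fin.last n))).dvd
    exact h01 (MvPolynomial.X_dvd_X.mp h2)

theorem primePoint_ideal {n : ℕ} (hn : 0 < n) {G : CoordRing n} (hG : Irreducible G) {e : ℕ}
    (he : G.IsHomogeneous e) :
    (primePoint hn hG he).asHomogeneousIdeal.toIdeal = Ideal.span {G} := rfl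

theorem isMax_iff {n : ℕ} (P : PSpace n) : IsMax P ↔ P.asHomogeneousIdeal.toIdeal = ⊥ := by
  constructor
  · intro h
    have h1 : P ≤ genericPoint (PSpace n) := by
      rw [le_iff_ideal, genericPoint_ideal]
      exact bot_le
    have h2 := (le_iff_ideal _ _).mp (h h1)
    rwa [genericPoint_ideal, le_bot_iff] at h2
  · intro h Q _
    rw [le_iff_ideal, h]
    exact bot_le

/-- Larger points in the specialization order have smaller ideals, and the generic point is the top,
so coheight measures chains of ideals descending to zero. -/
theorem coheight_eq_one_iff {n : ℕ} (P : PSpace n) :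
    coheight P = 1 ↔ P.asHomogeneousIdeal.toIdeal ≠ ⊥ ∧ ∀ Q : PSpace n,
      Q.asHomogeneousIdeal.toIdeal < P.asHomogeneousIdeal.toIdeal →
        Q.asHomogeneousIdeal.toIdeal = ⊥ := by
  simp_rw [← isMax_iff, ← lt_iff_ideal, Ne, ← isMax_iff, ← coheight_eq_zero]
  constructor
  · intro h
    refine ⟨by simp [h], fun Q hQ => ?_⟩
    have h1 := coheight_add_one_le hQ
    rw [h] at h1
    exact nonpos_iff_eq_zero.mp ((ENat.add_le_add_iff_right ENat.one_ne_top).mp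
      (h1.trans_eq (zero_add 1).symm))
  · rintro ⟨h0, h⟩
    refine le_antisymm (coheight_le_coe_iff.mpr fun Q hQ => ?_) (Order.one_le_iff_ne_zero.mpr h0)
    simp [h Q hQ]

theorem coheight_primePoint {n : ℕ} (hn : 0 < n) {G : CoordRing n} (hG : Irreducible G) {e : ℕ}
    (he : G.IsHomogeneous e) : coheight (primePoint hn hG he) = 1 := by
  rw [coheight_eq_one_iff, primePoint_ideal]
  refine ⟨by simpa using hG.ne_zero, fun Q hQ => ?_⟩
  by_contra h0
  obtain ⟨H, d, hH, hd, hHQ⟩ := exists_irreducible_mem Q h0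
  have h1 : G ∣ H := Ideal.mem_span_singleton.mp (hQ.le hHQ)
  have h2 : H ∣ G := ((hG.dvd_irreducible_iff_associated hH).mp h1).symm.dvd
  exact hQ.not_ge ((Ideal.span_singleton_le_iff_mem _).mpr (Ideal.mem_of_dvd _ h2 hHQ))

/-- The principal ideal of an irreducible form in the ideal of `P` is a nonzero homogeneous prime,
so by minimality it is the whole ideal. -/
theorem exists_eq_primePoint {n : ℕ} (hn : 0 < n) {P : PSpace n} (hP : coheight P = 1) :
    ∃ (G : CoordRing n) (e : ℕ) (hG : Irreducible G) (he : G.IsHomogeneous e),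
      P = primePoint hn hG he := by
  rw [coheight_eq_one_iff] at hP
  obtain ⟨G, e, hG, he, hGP⟩ := exists_irreducible_mem P hP.1
  refine ⟨G, e, hG, he, point_ext ?_⟩
  by_contra h
  have h1 : (primePoint hn hG he).asHomogeneousIdeal.toIdeal ≤ P.asHomogeneousIdeal.toIdeal :=
    (Ideal.span_singleton_le_iff_mem _).mpr hGP
  have h2 := hP.2 _ (lt_of_le_of_ne h1 (Ne.symm h))
  rw [primePoint_ideal, Ideal.span_singleton_eq_bot] at h2
  exact hG.ne_zero h2

theorem primePoint_eq_iff {n : ℕ} (hn : 0 < n) {G H : CoordRing n} (hG : Irreducible G) {e d : ℕ}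
    (he : G.IsHomogeneous e) (hH : Irreducible H) (hd : H.IsHomogeneous d) :
    primePoint hn hG he = primePoint hn hH hd ↔ Associated G H := by
  rw [← Ideal.span_singleton_eq_span_singleton, ← primePoint_ideal hn hG he,
    ← primePoint_ideal hn hH hd]
  exact ⟨fun h => h ▸ rfl, point_ext⟩

/-! ### Local rings and orders along prime divisors -/

theorem algebraMap_coordField_ne_zero {n : ℕ} {a : CoordRing n} (ha : a ≠ 0) :
    algebraMap (CoordRing n) (CoordField n) a ≠ 0 :=
  (map_ne_zero_iff _ (IsFractionRing.injective _ _)).mpr ha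

theorem algebraMap_coordField_injective (n : ℕ) :
    Function.Injective (algebraMap (CoordRing n) (CoordField n)) :=
  IsFractionRing.injective _ _

/-- Elements of the local ring at `P` as fractions of polynomials. -/
def stalkToFrac {n : ℕ} (P : PSpace n) : (PSpace n).presheaf.stalk P →+* CoordField n :=
  (toFrac n).comp (algebraMap _ (PSpace n).functionField)

theorem stalkToFrac_injective {n : ℕ} (P : PSpace n) : Function.Injective (stalkToFrac P) :=
  (toFrac_injective n).comp (IsFractionRing.injective _ _)

theorem stalkToFrac_stalkFrac {n : ℕ} (P : PSpace n)
    (c : HomogeneousLocalization.NumDenSameDeg (grading n)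
      P.asHomogeneousIdeal.toIdeal.primeCompl) :
    stalkToFrac P (stalkFrac P c) =
      algebraMap _ (CoordField n) (c.num : CoordRing n) / algebraMap _ _ (c.den : CoordRing n) :=
  toFrac_stalkFrac P c

theorem ne_zero_of_notMem {n : ℕ} {P : PSpace n} {b : CoordRing n}
    (hb : b ∉ P.asHomogeneousIdeal.toIdeal) : b ≠ 0 :=
  fun h => hb (h ▸ Ideal.zero_mem _)

theorem isUnit_stalkFrac_iff {n : ℕ} (P : PSpace n)
    (c : HomogeneousLocalization.NumDenSameDeg (grading n)
      P.asHomogeneousIdeal.toIdeal.primeCompl) :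
    IsUnit (stalkFrac P c) ↔ (c.num : CoordRing n) ∉ P.asHomogeneousIdeal.toIdeal := by
  have hd := algebraMap_coordField_ne_zero (ne_zero_of_notMem (P := P) c.den_mem)
  constructor
  · intro h
    obtain ⟨y, hy⟩ := h.exists_right_inv
    obtain ⟨c', rfl⟩ := stalkFrac_surjective P y
    have hd' := algebraMap_coordField_ne_zero (ne_zero_of_notMem (P := P) c'.den_mem)
    have h1 := congrArg (stalkToFrac P) hy
    rw [map_mul, map_one, stalkToFrac_stalkFrac, stalkToFrac_stalkFrac] at h1
    rw [div_mul_div_comm, div_eq_one_iff_eq (mul_ne_zero hd hd'), ← map_mul, ← map_mul] at h1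
    have h2 := algebraMap_coordField_injective n h1
    intro h3
    have h4 : (c.den : CoordRing n) * c'.den ∈ P.asHomogeneousIdeal.toIdeal :=
      h2 ▸ Ideal.mul_mem_right _ _ h3
    exact (Ideal.IsPrime.mem_or_mem inferInstance h4).elim c.den_mem c'.den_mem
  · intro h
    have hn := algebraMap_coordField_ne_zero (ne_zero_of_notMem (P := P) h)
    refine .of_mul_eq_one (stalkFrac P ⟨c.deg, c.den, c.num, h⟩) (stalkToFrac_injective P ?_)
    rw [map_mul, map_one, stalkToFrac_stalkFrac, stalkToFrac_stalkFrac]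
    field_simp

theorem exists_X_notMem {n : ℕ} (P : PSpace n) :
    ∃ i : Fin (n + 1), (MvPolynomial.X i : CoordRing n) ∉ P.asHomogeneousIdeal.toIdeal := by
  by_contra! h
  refine P.not_irrelevant_le fun z hz => ?_
  have h0 : MvPolynomial.homogeneousComponent 0 z = 0 := by
    have := (HomogeneousIdeal.mem_irrelevant_iff _ _).mp hz
    rw [GradedRing.proj_apply] at this
    exact (MvPolynomial.decomposition.decompose'_apply z 0).symm.trans this
  rw [MvPolynomial.homogeneousComponent_zero, MvPolynomial.C_eq_zero] at h0
  have h1 : z ∈ Ideal.span (Set.range (MvPolynomial.X : Fin (n + 1) → CoordRing n)) := by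
    rw [← Set.image_univ, MvPolynomial.mem_ideal_span_X_image]
    intro m hm
    by_contra! hc
    have : m = 0 := by
      ext i
      simpa using hc i
    exact (MvPolynomial.mem_support_iff.mp hm) (this ▸ h0)
  exact (Ideal.span_le.mpr (by rintro _ ⟨i, rfl⟩; exact h i)) h1

/-- The local equation `a / x_i ^ N` of a form `a` at a point with `x_i ≠ 0`. -/
def localForm {n : ℕ} (P : PSpace n) {i : Fin (n + 1)}
    (hi : (MvPolynomial.X i : CoordRing n) ∉ P.asHomogeneousIdeal.toIdeal) {a : CoordRing n} {N : ℕ}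
    (ha : a.IsHomogeneous N) : (PSpace n).presheaf.stalk P :=
  stalkFrac P ⟨N, ⟨a, ha⟩, ⟨MvPolynomial.X i ^ N, by
    simpa using (MvPolynomial.isHomogeneous_X ℂ i).pow N⟩,
    Submonoid.pow_mem _ (by simpa [Ideal.primeCompl] using hi) N⟩

theorem stalkToFrac_localForm {n : ℕ} (P : PSpace n) {i : Fin (n + 1)}
    (hi : (MvPolynomial.X i : CoordRing n) ∉ P.asHomogeneousIdeal.toIdeal) {a : CoordRing n} {N : ℕ}
    (ha : a.IsHomogeneous N) :
    stalkToFrac P (localForm P hi ha) = algebraMap _ (CoordField n) a /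
      algebraMap (CoordRing n) (CoordField n) (MvPolynomial.X i) ^ N := by
  rw [localForm, stalkToFrac_stalkFrac, map_pow]

theorem localForm_mul {n : ℕ} (P : PSpace n) {i : Fin (n + 1)}
    (hi : (MvPolynomial.X i : CoordRing n) ∉ P.asHomogeneousIdeal.toIdeal) {a b : CoordRing n} {M N : ℕ}
    (ha : a.IsHomogeneous M) (hb : b.IsHomogeneous N) :
    localForm P hi (ha.mul hb) = localForm P hi ha * localForm P hi hb := by
  apply stalkToFrac_injective
  rw [map_mul, stalkToFrac_localForm, stalkToFrac_localForm, stalkToFrac_localForm, map_mul,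
    pow_add, div_mul_div_comm]

section PrimePoint

variable {n : ℕ} (hn : 0 < n) {G : CoordRing n} (hG : Irreducible G) {e : ℕ}
  (he : G.IsHomogeneous e)

theorem mem_primePoint {a : CoordRing n} :
    a ∈ (primePoint hn hG he).asHomogeneousIdeal.toIdeal ↔ G ∣ a := by
  rw [primePoint_ideal, Ideal.mem_span_singleton]

/-- A numerator divisible by `G` is `G * b`, and the fraction factors in degree zero as `(G / xᵢ ^
e) * (xᵢ ^ e * b / den)`. -/
theorem maximalIdeal_stalk_primePoint {i : Fin (n + 1)}
    (hi : (MvPolynomial.X i : CoordRing n) ∉ (primePoint hn hG he).asHomogeneousIdeal.toIdeal) :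
    IsLocalRing.maximalIdeal ((PSpace n).presheaf.stalk (primePoint hn hG he)) =
      Ideal.span {localForm _ hi he} := by
  ext x
  rw [IsLocalRing.mem_maximalIdeal, mem_nonunits_iff, Ideal.mem_span_singleton]
  constructor
  · obtain ⟨c, rfl⟩ := stalkFrac_surjective _ x
    rw [isUnit_stalkFrac_iff, not_not, mem_primePoint]
    rintro ⟨b, hb⟩
    by_cases hb0 : b = 0
    · refine ⟨0, stalkToFrac_injective _ ?_⟩
      rw [stalkToFrac_stalkFrac, hb, hb0]
      simp
    obtain ⟨e', N', hN, he', hbN⟩ := exists_isHomogeneous_of_mul (hb ▸ c.num.2)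
      (mul_ne_zero hG.ne_zero hb0)
    obtain rfl := he'.inj_right he hG.ne_zero
    have hd := algebraMap_coordField_ne_zero (ne_zero_of_notMem (P := primePoint hn hG he) c.den_mem)
    have hX := algebraMap_coordField_ne_zero (ne_zero_of_notMem hi)
    have hmem : (MvPolynomial.X i : CoordRing n) ^ e' * b ∈ grading n c.deg := by
      rw [← hN]
      simpa using ((MvPolynomial.isHomogeneous_X ℂ i).pow e').mul hbN
    refine ⟨stalkFrac _ ⟨c.deg, ⟨_, hmem⟩, c.den, c.den_mem⟩, stalkToFrac_injective _ ?_⟩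
    rw [map_mul, stalkToFrac_localForm, stalkToFrac_stalkFrac, stalkToFrac_stalkFrac, hb]
    simp only [map_mul, map_pow]
    field_simp
  · intro h hx
    have := isUnit_of_dvd_unit h hx
    rw [localForm, isUnit_stalkFrac_iff, mem_primePoint] at this
    exact this dvd_rfl

theorem isDiscreteValuationRing_stalk_primePoint :
    IsDiscreteValuationRing ((PSpace n).presheaf.stalk (primePoint hn hG he)) := by
  obtain ⟨i, hi⟩ := exists_X_notMem (primePoint hn hG he)
  have hm := maximalIdeal_stalk_primePoint hn hG he hi
  have hf : ¬ IsField ((PSpace n).presheaf.stalk (primePoint hn hG he)) := by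
    rw [IsLocalRing.isField_iff_maximalIdeal_eq, hm, Ideal.span_singleton_eq_bot]
    intro h
    have := congrArg (stalkToFrac _) h
    rw [stalkToFrac_localForm, map_zero] at this
    exact (div_ne_zero (algebraMap_coordField_ne_zero hG.ne_zero)
      (pow_ne_zero _ (algebraMap_coordField_ne_zero (ne_zero_of_notMem hi)))) this
  have htfae : IsDiscreteValuationRing ((PSpace n).presheaf.stalk (primePoint hn hG he)) ↔
      (IsLocalRing.maximalIdeal _).IsPrincipal :=
    (IsDiscreteValuationRing.TFAE ((PSpace n).presheaf.stalk (primePoint hn hG he)) hf).out 0 4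
  exact htfae.mpr ⟨⟨_, hm⟩⟩

/-- Induction on the multiplicity: a form not divisible by `G` is a unit in the local ring, and each
factor `G` contributes the uniformizer, of order 1. -/
theorem ord_localForm {i : Fin (n + 1)}
    (hi : (MvPolynomial.X i : CoordRing n) ∉ (primePoint hn hG he).asHomogeneousIdeal.toIdeal) {a : CoordRing n}
    {N : ℕ} (ha : a.IsHomogeneous N) (ha0 : a ≠ 0) :
    Scheme.ord (algebraMap _ (PSpace n).functionField (localForm (primePoint hn hG he) hi ha))
      (primePoint hn hG he) = multiplicity G a := by
  have hdvr := isDiscreteValuationRing_stalk_primePoint hn hG he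
  have hm := maximalIdeal_stalk_primePoint hn hG he hi
  have hX := algebraMap_coordField_ne_zero (ne_zero_of_notMem hi)
  have hirr : Irreducible (localForm (primePoint hn hG he) hi he) :=
    (IsDiscreteValuationRing.irreducible_iff_uniformizer _).mpr hm
  have h0 : ∀ {b : CoordRing n} {M : ℕ} (hb : b.IsHomogeneous M), b ≠ 0 →
      algebraMap _ (PSpace n).functionField (localForm (primePoint hn hG he) hi hb) ≠ 0 := by
    intro b M hb hb0 h
    have h1 := congrArg (toFrac n) h
    rw [map_zero] at h1
    change stalkToFrac _ _ = 0 at h1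
    rw [stalkToFrac_localForm] at h1
    exact (div_ne_zero (algebraMap_coordField_ne_zero hb0) (pow_ne_zero _ hX)) h1
  have hc := coheight_primePoint hn hG he
  have h1 : Scheme.ord (algebraMap _ (PSpace n).functionField
      (localForm (primePoint hn hG he) hi he)) (primePoint hn hG he) = 1 := by
    rw [Scheme.ord_eq_iff hc (h0 he hG.ne_zero)]
    exact Ring.ordFrac_irreducible hirr
  induction hk : multiplicity G a generalizing a N with
  | zero =>
    rw [Nat.cast_zero, Scheme.ord_eq_iff hc (h0 ha ha0)]
    refine Ring.ordFrac_of_isUnit ?_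
    rw [localForm, isUnit_stalkFrac_iff, mem_primePoint]
    exact multiplicity_eq_zero.mp hk
  | succ k ih =>
    obtain ⟨b, rfl⟩ : G ∣ a := dvd_of_multiplicity_pos (by omega)
    have hb0 := right_ne_zero_of_mul ha0
    obtain ⟨e', M, hM, he', hb⟩ := exists_isHomogeneous_of_mul ha ha0
    obtain rfl := he'.inj_right he hG.ne_zero
    subst hM
    have hk' : multiplicity G b = k := by
      rw [multiplicity_mul_of_irreducible hG hG.ne_zero hb0, multiplicity_self] at hk
      omega
    rw [localForm_mul _ hi he' hb, map_mul, Scheme.ord_mul (h0 he hG.ne_zero) (h0 hb hb0), h1,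
      ih hb hb0 hk']
    push_cast
    ring

/-- The order of a fraction of forms along a prime divisor. -/
theorem ord_primePoint {g : (PSpace n).functionField} {a b : CoordRing n} {N : ℕ}
    (ha : a.IsHomogeneous N) (hb : b.IsHomogeneous N) (ha0 : a ≠ 0) (hb0 : b ≠ 0)
    (h : toFrac n g = algebraMap _ (CoordField n) a / algebraMap _ _ b) :
    Scheme.ord g (primePoint hn hG he) = (multiplicity G a : ℤ) - multiplicity G b := by
  obtain ⟨i, hi⟩ := exists_X_notMem (primePoint hn hG he)
  have hX := algebraMap_coordField_ne_zero (ne_zero_of_notMem hi)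
  have hb1 := algebraMap_coordField_ne_zero hb0
  have hg : g * algebraMap _ (PSpace n).functionField (localForm (primePoint hn hG he) hi hb) =
      algebraMap _ (PSpace n).functionField (localForm (primePoint hn hG he) hi ha) := by
    apply toFrac_injective
    rw [map_mul, h]
    change _ * stalkToFrac _ _ = stalkToFrac _ _
    rw [stalkToFrac_localForm, stalkToFrac_localForm]
    field_simp
  have hg0 : g ≠ 0 := by
    rintro rfl
    rw [map_zero] at h
    exact div_ne_zero (algebraMap_coordField_ne_zero ha0) hb1 h.symm
  have hl0 : algebraMap _ (PSpace n).functionField (localForm (primePoint hn hG he) hi hb) ≠ 0 := by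
    intro h1
    have h2 := congrArg (toFrac n) h1
    rw [map_zero] at h2
    change stalkToFrac _ _ = 0 at h2
    rw [stalkToFrac_localForm] at h2
    exact (div_ne_zero hb1 (pow_ne_zero _ hX)) h2
  have h3 := ord_localForm hn hG he hi ha ha0
  rw [← hg, Scheme.ord_mul hg0 hl0, ord_localForm hn hG he hi hb hb0] at h3
  omega

end PrimePoint

/-! ### Spaces of sections on `ℙⁿ` -/

/-- `toFrac` as a homomorphism of `ℂ`-algebras. -/
def toFracAlgHom (n : ℕ) : (PSpace n).functionField →ₐ[ℂ] CoordField n :=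
  { toFrac n with
    commutes' := fun c => (toFrac_const n c).trans
      (IsScalarTower.algebraMap_apply ℂ (CoordRing n) (CoordField n) c).symm }

theorem toFracAlgHom_apply {n : ℕ} (g : (PSpace n).functionField) :
    toFracAlgHom n g = toFrac n g := rfl

/-- Counts the monomials of degree `N` in `n + 1` variables. -/
theorem finrank_homogeneousSubmodule (n N : ℕ) :
    Module.finrank ℂ (grading n N) = (N + n).choose n := by
  have hs : {d : Fin (n + 1) →₀ ℕ | d.degree = N} =
      ((Finset.univ : Finset (Fin (n + 1))).finsuppAntidiag N : Set (Fin (n + 1) →₀ ℕ)) := by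
    ext d
    simp [Finset.mem_finsuppAntidiag, Finsupp.degree_eq_sum]
  have h : Module.finrank ℂ (grading n N) =
      Module.finrank ℂ (MvPolynomial.restrictSupport ℂ {d : Fin (n + 1) →₀ ℕ | d.degree = N}) :=
    congrArg (fun V : Submodule ℂ (CoordRing n) => Module.finrank ℂ V)
      (MvPolynomial.homogeneousSubmodule_eq_finsupp_supported (Fin (n + 1)) ℂ N)
  rw [h, Module.finrank_eq_nat_card_basis (MvPolynomial.basisRestrictSupport ℂ _), hs,
    Nat.card_coe_set_eq, Set.ncard_coe_finset, Finset.card_finsuppAntidiag_nat_eq_choose,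
    Finset.card_univ, Fintype.card_fin]
  rw [show n + 1 + N - 1 = N + n by omega, Nat.choose_symm_add]

instance finite_homogeneousSubmodule (n N : ℕ) : Module.Finite ℂ (grading n N) :=
  Module.finite_of_finrank_pos (by
    rw [finrank_homogeneousSubmodule]
    exact Nat.choose_pos (Nat.le_add_left n N))

/-- The rational functions `C · q / p` with `C` a form of degree `N`. -/
def twistedForms {n : ℕ} (p q : CoordRing n) (N : ℕ) : Submodule ℂ (CoordField n) :=
  (grading n N).map ((LinearMap.mulLeft ℂ (algebraMap (CoordRing n) (CoordField n) q /
    algebraMap _ _ p)).comp (Algebra.linearMap (CoordRing n) (CoordField n) |>.restrictScalars ℂ))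

theorem mem_twistedForms {n : ℕ} {p q : CoordRing n} {N : ℕ} {f : CoordField n} :
    f ∈ twistedForms p q N ↔ ∃ C : CoordRing n, C.IsHomogeneous N ∧
      algebraMap (CoordRing n) (CoordField n) q / algebraMap _ _ p * algebraMap _ _ C = f := by
  rw [twistedForms, Submodule.mem_map]
  rfl

theorem finrank_twistedForms {n : ℕ} {p q : CoordRing n} (hp : p ≠ 0) (hq : q ≠ 0) (N : ℕ) :
    Module.finrank ℂ (twistedForms p q N) = (N + n).choose n := by
  rw [← finrank_homogeneousSubmodule, twistedForms]
  refine (LinearEquiv.finrank_eq (Submodule.equivMapOfInjective _ ?_ _)).symm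
  intro a b h
  have h1 : algebraMap (CoordRing n) (CoordField n) q / algebraMap _ _ p * algebraMap _ _ a =
    algebraMap (CoordRing n) (CoordField n) q / algebraMap _ _ p * algebraMap _ _ b := h
  exact algebraMap_coordField_injective n (mul_left_cancel₀ (div_ne_zero
    (algebraMap_coordField_ne_zero hq) (algebraMap_coordField_ne_zero hp)) h1)

instance {n : ℕ} (p q : CoordRing n) (N : ℕ) : Module.Finite ℂ (twistedForms p q N) := by
  rw [twistedForms]
  infer_instance

section Sections

variable {n : ℕ} (hn : 0 < n) {D : PSpace n → ℝ} {p q : CoordRing n} {u v : ℕ}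
  (hp : p.IsHomogeneous u) (hq : q.IsHomogeneous v) (hp0 : p ≠ 0) (hq0 : q ≠ 0)

include hp hq hp0 hq0 in
/-- A rational function whose divisor is at least `div q - div p` is `C q / p` for a form `C`. -/
theorem exists_form_of_ord_nonneg (g : (PSpace n).functionField) (hg : g ≠ 0)
    (h : ∀ (H : CoordRing n) (e : ℕ) (hH : Irreducible H) (he : H.IsHomogeneous e),
      0 ≤ Scheme.ord g (primePoint hn hH he) + (multiplicity H p - multiplicity H q)) :
    v ≤ u ∧ toFrac n g ∈ twistedForms p q (u - v) := by
  obtain ⟨N, a, b, ha, hb, hb0, hab⟩ := exists_toFrac_eq g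
  have ha0 : a ≠ 0 := by
    rintro rfl
    rw [map_zero, zero_div] at hab
    exact hg ((map_eq_zero _).mp hab)
  -- Writing `g = a / b`, the inequality of orders says that every irreducible form occurs in `b *
  -- q` at most as often as in `a * p`. The quotient is the form `C`.
  have hdvd : b * q ∣ a * p := by
    refine dvd_of_forall_multiplicity_le (mul_ne_zero hb0 hq0) (mul_ne_zero ha0 hp0)
      (ha.mul hp) (hb.mul hq) fun H e hH he => ?_
    have h1 := h H e hH he
    rw [ord_primePoint hn hH he ha hb ha0 hb0 hab] at h1
    rw [multiplicity_mul_of_irreducible hH hb0 hq0, multiplicity_mul_of_irreducible hH ha0 hp0]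
    omega
  obtain ⟨C, hC⟩ := hdvd
  have hap := mul_ne_zero ha0 hp0
  obtain ⟨i, j, hij, hi, hj⟩ := exists_isHomogeneous_of_mul (hC ▸ ha.mul hp) (hC ▸ hap)
  have hi' := hi.inj_right (hb.mul hq) (mul_ne_zero hb0 hq0)
  refine ⟨by omega, mem_twistedForms.mpr ⟨C, ?_, ?_⟩⟩
  · rwa [show u - v = j by omega]
  · have h2 := congrArg (algebraMap (CoordRing n) (CoordField n)) hC
    simp only [map_mul] at h2
    have := algebraMap_coordField_ne_zero hb0
    have := algebraMap_coordField_ne_zero hp0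
    rw [hab]
    field_simp
    linear_combination -h2

include hp hq hp0 hq0 in
-- Since `D ≤ div p - div q`, every section has the shape `C q / p`. Finiteness is part of the
-- conclusion because `Module.finrank` is 0 on infinite-dimensional spaces, so the lower bound in
-- `le_finrank_sections` depends on it.
theorem finrank_sections_le
    (h : ∀ (H : CoordRing n) (e : ℕ) (hH : Irreducible H) (he : H.IsHomogeneous e),
      D (primePoint hn hH he) ≤ (multiplicity H p : ℝ) - multiplicity H q) :
    Module.Finite ℂ (sections (RingHom.id (PSpace n).functionField) D) ∧
    Module.finrank ℂ (sections (RingHom.id (PSpace n).functionField) D) ≤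
      if v ≤ u then (u - v + n).choose n else 0 := by
  have key : ∀ g : (PSpace n).functionField, g ≠ 0 → (∀ P : PSpace n, coheight P = 1 →
      0 ≤ (Scheme.ord g P : ℝ) + D P) → v ≤ u ∧ toFrac n g ∈ twistedForms p q (u - v) := by
    intro g hg hgD
    refine exists_form_of_ord_nonneg hn hp hq hp0 hq0 g hg fun H e hH he => ?_
    have h1 := hgD _ (coheight_primePoint hn hH he)
    have h2 := h H e hH he
    have h3 : (0 : ℝ) ≤ (Scheme.ord g (primePoint hn hH he) : ℝ) +
      ((multiplicity H p : ℝ) - multiplicity H q) := by linarith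
    exact_mod_cast h3
  split_ifs with huv
  · have hle : (sections (RingHom.id (PSpace n).functionField) D).map
        (toFracAlgHom n).toLinearMap ≤ twistedForms p q (u - v) := by
      rw [Submodule.map_le_iff_le_comap, sections, Submodule.span_le]
      rintro g hg
      by_cases hg0 : g = 0
      · rw [hg0]; exact Submodule.zero_mem _
      · exact (key g hg0 (hg.resolve_left hg0)).2
    have he := Submodule.equivMapOfInjective (toFracAlgHom n).toLinearMap (toFrac_injective n)
      (sections (RingHom.id (PSpace n).functionField) D)
    have : Module.Finite ℂ ((sections (RingHom.id (PSpace n).functionField) D).map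
        (toFracAlgHom n).toLinearMap) := Submodule.finiteDimensional_of_le hle
    refine ⟨Module.Finite.equiv he.symm, ?_⟩
    rw [he.finrank_eq, ← finrank_twistedForms hp0 hq0]
    exact Submodule.finrank_mono hle
  · have hbot : sections (RingHom.id (PSpace n).functionField) D = ⊥ := by
      rw [sections, Submodule.span_eq_bot]
      intro g hg
      by_contra hg0
      exact huv (key g hg0 (hg.resolve_left hg0)).1
    rw [hbot]
    exact ⟨inferInstance, by simp⟩

include hp hq hp0 hq0 in
theorem le_finrank_sections
    (hfin : Module.Finite ℂ (sections (RingHom.id (PSpace n).functionField) D))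
    (h : ∀ (H : CoordRing n) (e : ℕ) (hH : Irreducible H) (he : H.IsHomogeneous e),
      (multiplicity H p : ℝ) - multiplicity H q ≤ D (primePoint hn hH he)) :
    (if v ≤ u then (u - v + n).choose n else 0) ≤
      Module.finrank ℂ (sections (RingHom.id (PSpace n).functionField) D) := by
  split_ifs with huv
  swap
  · exact Nat.zero_le _
  have hle : twistedForms p q (u - v) ≤ (sections (RingHom.id (PSpace n).functionField) D).map
      (toFracAlgHom n).toLinearMap := by
    intro f hf
    obtain ⟨C, hC, rfl⟩ := mem_twistedForms.mp hf
    have hqC : (q * C).IsHomogeneous u := by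
      have := hq.mul hC
      rwa [show v + (u - v) = u by omega] at this
    obtain ⟨g, hg⟩ := exists_toFrac_eq_div hqC hp hp0
    refine ⟨g, Submodule.subset_span ?_, ?_⟩
    · by_cases hC0 : C = 0
      · refine Or.inl ((map_eq_zero (toFrac n)).mp ?_)
        rw [hg, hC0]
        simp
      refine Or.inr fun P hP => ?_
      obtain ⟨H, e, hH, he, rfl⟩ := exists_eq_primePoint hn hP
      rw [RingHom.id_apply, ord_primePoint hn hH he hqC hp (mul_ne_zero hq0 hC0) hp0 hg,
        multiplicity_mul_of_irreducible hH hq0 hC0]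
      have := h H e hH he
      push_cast
      have : (0 : ℝ) ≤ multiplicity H C := Nat.cast_nonneg _
      linarith
    · rw [AlgHom.toLinearMap_apply, toFracAlgHom_apply, hg, map_mul]
      ring
  have he := Submodule.equivMapOfInjective (toFracAlgHom n).toLinearMap (toFrac_injective n)
    (sections (RingHom.id (PSpace n).functionField) D)
  rw [he.finrank_eq, ← finrank_twistedForms hp0 hq0]
  exact Submodule.finrank_mono hle

end Sections

/-! ### Asymptotics of dimensions of spaces of forms -/

section Limits

/-- The dimension of the space of forms of degree `N` in `n + 1` variables. -/
def formsDim (n : ℕ) (N : ℤ) : ℕ := if 0 ≤ N then (N.toNat + n).choose n else 0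

theorem formsDim_div (n : ℕ) (N : ℤ) (m : ℝ) :
    (formsDim n N : ℝ) / (m ^ n / (n.factorial : ℝ)) =
      if 0 ≤ N then ∏ i ∈ Finset.range n, (((max N 0 : ℤ) : ℝ) / m + ((1 + i : ℕ) : ℝ) / m)
        else 0 := by
  rw [formsDim]
  split_ifs with h
  · have h1 : (((N.toNat + n).choose n : ℕ) : ℝ) * n.factorial =
        ∏ i ∈ Finset.range n, ((N.toNat : ℝ) + (1 + i : ℕ)) := by
      have := Nat.ascFactorial_eq_prod_range (N.toNat + 1) n
      rw [Nat.ascFactorial_eq_factorial_mul_choose] at this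
      have h2 := congrArg (Nat.cast (R := ℝ)) this
      push_cast at h2 ⊢
      rw [mul_comm, h2]
      exact Finset.prod_congr rfl fun i _ => by ring
    have h3 : ((max N 0 : ℤ) : ℝ) = (N.toNat : ℝ) := by
      have : ((N.toNat : ℤ) : ℝ) = ((max N 0 : ℤ) : ℝ) := congrArg _ (Int.ofNat_toNat N)
      exact this.symm
    rw [div_div_eq_mul_div, h1, h3, show m ^ n = ∏ i ∈ Finset.range n, m by simp,
      ← Finset.prod_div_distrib]
    exact Finset.prod_congr rfl fun i _ => by ring
  · simp

theorem tendsto_formsDim {n : ℕ} (hn : 0 < n) {N : ℕ → ℤ} {ρ : ℝ}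
    (hN : Tendsto (fun m : ℕ => (N m : ℝ) / m) atTop (nhds ρ)) :
    Tendsto (fun m : ℕ => (formsDim n (N m) : ℝ) / ((m : ℝ) ^ n / (n.factorial : ℝ))) atTop
      (nhds (max ρ 0 ^ n)) := by
  simp_rw [formsDim_div]
  have h1 : Tendsto (fun m : ℕ => ((max (N m) 0 : ℤ) : ℝ) / m) atTop (nhds (max ρ 0)) := by
    refine (hN.max tendsto_const_nhds).congr fun m => ?_
    rw [Int.cast_max, Int.cast_zero, ← max_div_div_right (Nat.cast_nonneg m), zero_div]
  have h2 : Tendsto (fun m : ℕ => ∏ i ∈ Finset.range n,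
      (((max (N m) 0 : ℤ) : ℝ) / m + ((1 + i : ℕ) : ℝ) / m)) atTop (nhds (max ρ 0 ^ n)) := by
    have := tendsto_finsetProd (Finset.range n) (fun i _ => h1.add
      (tendsto_const_div_atTop_nhds_zero_nat ((1 + i : ℕ) : ℝ)))
    simpa using this
  -- For `ρ > 0` the degrees are eventually positive and the product formula applies. For `ρ ≤ 0`
  -- their sign may vary, but both branches lie between 0 and the product, which tends to 0 because
  -- `n > 0`.
  rcases le_or_gt ρ 0 with hρ | hρ
  · rw [max_eq_right hρ, zero_pow hn.ne'] at h2 ⊢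
    have h0 : ∀ m : ℕ, 0 ≤ ∏ i ∈ Finset.range n,
        (((max (N m) 0 : ℤ) : ℝ) / m + ((1 + i : ℕ) : ℝ) / m) := fun m =>
      Finset.prod_nonneg fun i _ => by
        have : (0 : ℝ) ≤ ((max (N m) 0 : ℤ) : ℝ) := by exact_mod_cast le_max_right _ _
        positivity
    refine squeeze_zero (fun m => ?_) (fun m => ?_) h2
    · split_ifs
      · exact h0 m
      · exact le_rfl
    · split_ifs
      · exact le_rfl
      · exact h0 m
  · refine h2.congr' ?_
    filter_upwards [hN.eventually_const_lt hρ, eventually_gt_atTop 0] with m hm hm0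
    have : (0 : ℝ) < N m := by
      by_contra! h
      exact hm.not_ge (div_nonpos_of_nonpos_of_nonneg h (Nat.cast_nonneg m))
    rw [if_pos (by exact_mod_cast this.le)]

theorem tendsto_floor_mul_div (c : ℝ) :
    Tendsto (fun m : ℕ => ((⌊m * c⌋ : ℤ) : ℝ) / m) atTop (nhds c) := by
  have h : Tendsto (fun m : ℕ => c - 1 / (m : ℝ)) atTop (nhds c) := by
    simpa using tendsto_const_nhds.sub (tendsto_const_div_atTop_nhds_zero_nat (1 : ℝ))
  refine tendsto_of_tendsto_of_tendsto_of_le_of_le' h tendsto_const_nhds ?_ ?_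
  · filter_upwards [eventually_gt_atTop 0] with m hm
    have hm' : (0 : ℝ) < m := Nat.cast_pos.mpr hm
    rw [le_div_iff₀ hm', sub_mul, div_mul_cancel₀ _ hm'.ne', mul_comm]
    exact (Int.sub_one_lt_floor _).le
  · filter_upwards [eventually_gt_atTop 0] with m hm
    have hm' : (0 : ℝ) < m := Nat.cast_pos.mpr hm
    rw [div_le_iff₀ hm', mul_comm c]
    exact Int.floor_le _

theorem tendsto_ceil_mul_div (c : ℝ) :
    Tendsto (fun m : ℕ => ((⌈m * c⌉ : ℤ) : ℝ) / m) atTop (nhds c) := by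
  have h := (tendsto_floor_mul_div (-c)).neg
  rw [neg_neg] at h
  refine h.congr fun m => ?_
  rw [mul_neg, Int.floor_neg]
  push_cast
  ring

end Limits

/-! ### Volumes of real combinations of hypersurfaces -/

section Volume

variable {n : ℕ} {ι : Type*} [Fintype ι] {f : ι → CoordRing n} {d : ι → ℕ}

/-- The product of the forms `f l` with the positive parts of the exponents `k l`. -/
def posProd (f : ι → CoordRing n) (k : ι → ℤ) : CoordRing n := ∏ l, f l ^ (k l).toNat

theorem posProd_ne_zero (hf0 : ∀ l, f l ≠ 0) (k : ι → ℤ) : posProd f k ≠ 0 :=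
  Finset.prod_ne_zero_iff.mpr fun l _ => pow_ne_zero _ (hf0 l)

theorem isHomogeneous_posProd (hf : ∀ l, (f l).IsHomogeneous (d l)) (k : ι → ℤ) :
    (posProd f k).IsHomogeneous (∑ l, d l * (k l).toNat) :=
  MvPolynomial.IsHomogeneous.prod _ _ _ fun l _ => (hf l).pow _

theorem multiplicity_posProd (hf0 : ∀ l, f l ≠ 0) (k : ι → ℤ) {H : CoordRing n}
    (hH : Irreducible H) :
    multiplicity H (posProd f k) = ∑ l, (k l).toNat * multiplicity H (f l) := by
  rw [posProd]
  classical
  have : ∀ s : Finset ι, multiplicity H (∏ l ∈ s, f l ^ (k l).toNat) =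
      ∑ l ∈ s, (k l).toNat * multiplicity H (f l) := by
    intro s
    induction s using Finset.induction_on with
    | empty =>
      rw [Finset.prod_empty, Finset.sum_empty, multiplicity_of_one_right hH.not_isUnit]
    | insert l s hl ih =>
      rw [Finset.prod_insert hl, Finset.sum_insert hl, multiplicity_mul_of_irreducible hH
        (pow_ne_zero _ (hf0 l)) (Finset.prod_ne_zero_iff.mpr fun l _ => pow_ne_zero _ (hf0 l)), ih,
        (finiteMultiplicity_of_irreducible hH (hf0 l)).multiplicity_pow hH.prime]
  exact this _

/-- The fraction `posProd f k / posProd f (-k)` stands for the product of the `f l` with the integer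
exponents `k l`: numerator and denominator collect the positive and the negative exponents. -/
theorem multiplicity_posProd_sub (hf0 : ∀ l, f l ≠ 0) (k : ι → ℤ) {H : CoordRing n}
    (hH : Irreducible H) :
    (multiplicity H (posProd f k) : ℝ) - multiplicity H (posProd f (-k)) =
      ∑ l, (k l : ℝ) * multiplicity H (f l) := by
  rw [multiplicity_posProd hf0 _ hH, multiplicity_posProd hf0 _ hH]
  push_cast
  rw [← Finset.sum_sub_distrib]
  refine Finset.sum_congr rfl fun l _ => ?_
  rw [← sub_mul]
  congr 1
  have := Int.toNat_sub_toNat_neg (k l)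
  rw [Pi.neg_apply]
  exact_mod_cast this

theorem formsDim_eq (k : ι → ℤ) :
    (if ∑ l, d l * ((-k) l).toNat ≤ ∑ l, d l * (k l).toNat then
      (∑ l, d l * (k l).toNat - ∑ l, d l * ((-k) l).toNat + n).choose n else 0) =
      formsDim n (∑ l, k l * d l) := by
  have h : ∑ l, k l * (d l : ℤ) =
      ((∑ l, d l * (k l).toNat : ℕ) : ℤ) - ((∑ l, d l * ((-k) l).toNat : ℕ) : ℤ) := by
    push_cast
    rw [← Finset.sum_sub_distrib]
    refine Finset.sum_congr rfl fun l _ => ?_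
    rw [← mul_sub, mul_comm]
    congr 1
    have := Int.toNat_sub_toNat_neg (k l)
    rw [Pi.neg_apply]
    omega
  rw [h, formsDim]
  refine if_congr (by omega) ?_ rfl
  congr 2
  omega

/-- The volume of a divisor that is a real combination of divisors of forms. -/
theorem vol_eq (hn : 0 < n) (hf : ∀ l, (f l).IsHomogeneous (d l)) (hf0 : ∀ l, f l ≠ 0)
    {D : PSpace n → ℝ} {c : ι → ℝ}
    (hD : ∀ (H : CoordRing n) (e : ℕ) (hH : Irreducible H) (he : H.IsHomogeneous e),
      D (primePoint hn hH he) = ∑ l, c l * multiplicity H (f l)) :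
    vol (RingHom.id (PSpace n).functionField) n D = max (∑ l, c l * d l) 0 ^ n := by
  -- The coefficients `m * c l` of the forms are rounded, rather than those of `D` at each prime
  -- divisor. Rounding up or down changes the degree by a bounded amount, which disappears after
  -- division by `m`.
  have hu : ∀ m : ℕ, Module.Finite ℂ (sections (RingHom.id (PSpace n).functionField)
        fun P => m * D P) ∧
      Module.finrank ℂ (sections (RingHom.id (PSpace n).functionField) fun P => m * D P) ≤
        formsDim n (∑ l, ⌈m * c l⌉ * d l) := by
    intro m
    rw [← formsDim_eq fun l => ⌈m * c l⌉]
    refine finrank_sections_le hn (isHomogeneous_posProd hf _) (isHomogeneous_posProd hf _)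
      (posProd_ne_zero hf0 _) (posProd_ne_zero hf0 _) fun H e hH he => ?_
    rw [multiplicity_posProd_sub hf0 _ hH, hD, Finset.mul_sum]
    refine Finset.sum_le_sum fun l _ => ?_
    rw [← mul_assoc]
    exact mul_le_mul_of_nonneg_right (Int.le_ceil _) (Nat.cast_nonneg _)
  have hl : ∀ m : ℕ, formsDim n (∑ l, ⌊m * c l⌋ * d l) ≤
      Module.finrank ℂ (sections (RingHom.id (PSpace n).functionField) fun P => m * D P) := by
    intro m
    rw [← formsDim_eq fun l => ⌊m * c l⌋]
    refine le_finrank_sections hn (isHomogeneous_posProd hf _) (isHomogeneous_posProd hf _)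
      (posProd_ne_zero hf0 _) (posProd_ne_zero hf0 _) (hu m).1 fun H e hH he => ?_
    rw [multiplicity_posProd_sub hf0 _ hH, hD, Finset.mul_sum]
    refine Finset.sum_le_sum fun l _ => ?_
    rw [← mul_assoc]
    exact mul_le_mul_of_nonneg_right (Int.floor_le _) (Nat.cast_nonneg _)
  have hlim : ∀ k : ℕ → ι → ℤ, (∀ l, Tendsto (fun m : ℕ => (k m l : ℝ) / m) atTop (nhds (c l))) →
      Tendsto (fun m : ℕ => (formsDim n (∑ l, k m l * d l) : ℝ) /
        ((m : ℝ) ^ n / (n.factorial : ℝ))) atTop (nhds (max (∑ l, c l * d l) 0 ^ n)) := by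
    intro k hk
    refine tendsto_formsDim hn ?_
    refine (tendsto_finsetSum Finset.univ fun l _ => (hk l).mul_const (d l : ℝ)).congr fun m => ?_
    push_cast
    rw [Finset.sum_div]
    exact Finset.sum_congr rfl fun l _ => by ring
  refine Tendsto.limsup_eq (tendsto_of_tendsto_of_tendsto_of_le_of_le
    (hlim _ fun l => tendsto_floor_mul_div (c l)) (hlim _ fun l => tendsto_ceil_mul_div (c l))
    (fun m => ?_) fun m => ?_)
  · exact div_le_div_of_nonneg_right (Nat.cast_le.mpr (hl m)) (by positivity)
  · exact div_le_div_of_nonneg_right (Nat.cast_le.mpr (hu m).2) (by positivity)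

end Volume

/-! ### An integral and a determinant identity -/

theorem integral_max_sub_mul_pow (n : ℕ) {r e : ℝ} (hr : 0 < r) (he : 0 < e) :
    ∫ t in Set.Ioi (0 : ℝ), max (r - t * e) 0 ^ (n + 1) = r ^ (n + 2) / (e * (n + 2)) := by
  have h0 : 0 ≤ r / e := (div_pos hr he).le
  have h1 : ∫ t in Set.Ioi (0 : ℝ), max (r - t * e) 0 ^ (n + 1) =
      ∫ t in Set.Ioc (0 : ℝ) (r / e), (r - e * t) ^ (n + 1) := by
    refine (setIntegral_eq_of_subset_of_forall_sdiff_eq_zero measurableSet_Ioi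
      Set.Ioc_subset_Ioi_self ?_).trans (setIntegral_congr_fun measurableSet_Ioc fun t ht => ?_)
    · intro t ht
      have h2 : r / e < t := by
        by_contra! h
        exact ht.2 ⟨ht.1, h⟩
      have := (div_lt_iff₀ he).mp h2
      rw [max_eq_right (by linarith), zero_pow (Nat.succ_ne_zero n)]
    · have := (le_div_iff₀ he).mp ht.2
      rw [mul_comm t e] at this
      simp only [mul_comm t e]
      rw [max_eq_left (sub_nonneg.mpr this)]
  rw [h1, ← intervalIntegral.integral_of_le h0,
    intervalIntegral.integral_comp_sub_mul (fun x => x ^ (n + 1)) he.ne', integral_pow,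
    mul_div_cancel₀ _ he.ne']
  simp only [smul_eq_mul]
  push_cast
  field_simp
  ring

/-- Both sides are alternating in the rows of `A`, so it suffices to compare them on injective
families of standard basis vectors. These are permutations, and both sides give the sign times `f
v`. -/
theorem alternatingMap_sum_smul {K V W : Type*} [Field K] [AddCommGroup V] [Module K V]
    [AddCommGroup W] [Module K W] {n : ℕ} (f : V [⋀^Fin n]→ₗ[K] W) (A : Matrix (Fin n) (Fin n) K)
    (v : Fin n → V) : (f fun i => ∑ j, A i j • v j) = A.det • f v := by
  have h : f.compLinearMap (Fintype.linearCombination K v) =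
      (LinearMap.toSpanSingleton K W (f v)).compAlternatingMap Matrix.detRowAlternating := by
    refine Module.Basis.ext_alternating (Pi.basisFun K (Fin n)) fun σ hσ => ?_
    obtain ⟨τ, rfl⟩ : ∃ τ : Equiv.Perm (Fin n), σ = τ :=
      ⟨Equiv.ofBijective σ (Finite.injective_iff_bijective.mp hσ), rfl⟩
    have h1 : (Matrix.detRowAlternating fun i => Pi.basisFun K (Fin n) (τ i) : K) =
        Equiv.Perm.sign τ • (1 : K) := by
      have := (Matrix.detRowAlternating (R := K) (n := Fin n)).map_perm
        (fun i => Pi.basisFun K (Fin n) i) τ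
      rw [← Pi.basisFun_det] at this ⊢
      refine this.trans ?_
      rw [Module.Basis.det_self]
    rw [AlternatingMap.compLinearMap_apply, LinearMap.compAlternatingMap_apply, h1]
    have h2 : (fun i => Fintype.linearCombination K v (Pi.basisFun K (Fin n) (τ i))) = v ∘ τ := by
      ext i
      simp [Fintype.linearCombination_apply, Pi.single_apply]
    rw [h2, AlternatingMap.map_perm]
    simp
  exact congrArg (fun g => g A) h

/-! ### Derivations of the field of fractions -/

/-- The partial derivative `∂ / ∂xᵢ` on the fraction field of the coordinate ring. -/
def pderivFrac {n : ℕ} (i : Fin (n + 1)) : Derivation ℂ (CoordField n) (CoordField n) :=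
  -- Localization is formally étale, so the differentials of the fraction field are the base change
  -- of those of the polynomial ring. They have the basis `d xᵢ`, and the derivation is its `i`-th
  -- coordinate.
  have : Algebra.FormallyEtale (CoordRing n) (CoordField n) :=
    Algebra.FormallyEtale.of_isLocalization (nonZeroDivisors (CoordRing n))
  (((Algebra.TensorProduct.basis (CoordField n)
    (KaehlerDifferential.mvPolynomialBasis ℂ (Fin (n + 1)))).coord i).comp
    (KaehlerDifferential.tensorKaehlerEquivOfFormallyEtale ℂ (CoordRing n)
      (CoordField n)).symm.toLinearMap).compDer (KaehlerDifferential.D ℂ (CoordField n))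

theorem pderivFrac_algebraMap {n : ℕ} (i : Fin (n + 1)) (p : CoordRing n) :
    pderivFrac i (algebraMap (CoordRing n) (CoordField n) p) =
      algebraMap _ _ (MvPolynomial.pderiv i p) := by
  have : Algebra.FormallyEtale (CoordRing n) (CoordField n) :=
    Algebra.FormallyEtale.of_isLocalization (nonZeroDivisors (CoordRing n))
  change ((Algebra.TensorProduct.basis (CoordField n)
    (KaehlerDifferential.mvPolynomialBasis ℂ (Fin (n + 1)))).coord i)
    ((KaehlerDifferential.tensorKaehlerEquivOfFormallyEtale ℂ (CoordRing n)
      (CoordField n)).symm (KaehlerDifferential.D ℂ (CoordField n) _)) = _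
  rw [KaehlerDifferential.tensorKaehlerEquivOfFormallyEtale_symm_D_algebraMap,
    Module.Basis.coord_apply, Algebra.TensorProduct.basis_repr_tmul]
  simp

/-! ### Coordinate differentials on the affine charts -/

section Chart

variable {n : ℕ}

theorem exists_ratio (i s : Fin (n + 1)) : ∃ g, toFrac n g =
    algebraMap (CoordRing n) (CoordField n) (MvPolynomial.X i) /
      algebraMap (CoordRing n) (CoordField n) (MvPolynomial.X s) :=
  exists_toFrac_eq_div (MvPolynomial.isHomogeneous_X ℂ i) (MvPolynomial.isHomogeneous_X ℂ s)
    (MvPolynomial.X_ne_zero s)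

/-- The rational function `xᵢ / xₛ`. -/
def ratio (i s : Fin (n + 1)) : (PSpace n).functionField := (exists_ratio i s).choose

theorem toFrac_ratio (i s : Fin (n + 1)) : toFrac n (ratio i s) =
    algebraMap (CoordRing n) (CoordField n) (MvPolynomial.X i) /
      algebraMap (CoordRing n) (CoordField n) (MvPolynomial.X s) :=
  (exists_ratio i s).choose_spec

theorem X_ne_zero' (s : Fin (n + 1)) :
    algebraMap (CoordRing n) (CoordField n) (MvPolynomial.X s) ≠ 0 :=
  algebraMap_coordField_ne_zero (MvPolynomial.X_ne_zero s)

theorem ratio_self (s : Fin (n + 1)) : ratio s s = 1 := by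
  apply toFrac_injective
  rw [toFrac_ratio, div_self (X_ne_zero' s), map_one]

theorem ratio_ne_zero (i s : Fin (n + 1)) : ratio i s ≠ 0 := by
  intro h
  have := toFrac_ratio i s
  rw [h, map_zero] at this
  exact div_ne_zero (X_ne_zero' i) (X_ne_zero' s) this.symm

theorem ratio_mul_ratio (i j s : Fin (n + 1)) : ratio i j * ratio j s = ratio i s := by
  apply toFrac_injective
  rw [map_mul, toFrac_ratio, toFrac_ratio, toFrac_ratio]
  have := X_ne_zero' j
  field_simp

/-- The derivation `∂ / ∂xᵢ`, restricted to functions of degree zero, sends `xⱼ / xₛ` to `1 / xₛ` if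
`j = i` and to 0 otherwise, so applying it to a relation isolates one coefficient. -/
theorem linearIndependent_D_ratio (s : Fin (n + 1)) :
    LinearIndependent (PSpace n).functionField fun j : Fin n =>
      KaehlerDifferential.D ℂ (PSpace n).functionField (ratio (s.succAbove j) s) := by
  let alg : Algebra (PSpace n).functionField (CoordField n) := (toFrac n).toAlgebra
  have tower : IsScalarTower ℂ (PSpace n).functionField (CoordField n) :=
    .of_algebraMap_eq' (toFracAlgHom n).comp_algebraMap.symm
  rw [Fintype.linearIndependent_iff]
  intro c hc i
  let δ : Derivation ℂ (PSpace n).functionField (CoordField n) :=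
    (pderivFrac (s.succAbove i)).compAlgebraMap _
  have hδ : ∀ g, δ g = pderivFrac (s.succAbove i) (toFrac n g) := fun g => rfl
  have h1 : ∀ j, δ (ratio (s.succAbove j) s) =
      if j = i then (algebraMap (CoordRing n) (CoordField n) (MvPolynomial.X s))⁻¹ else 0 := by
    intro j
    have h2 : pderivFrac (s.succAbove i) (toFrac n (ratio (s.succAbove j) s) *
        algebraMap (CoordRing n) (CoordField n) (MvPolynomial.X s)) = if j = i then 1 else 0 := by
      rw [toFrac_ratio, div_mul_cancel₀ _ (X_ne_zero' s), pderivFrac_algebraMap,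
        MvPolynomial.pderiv_X]
      by_cases hj : j = i
      · simp [hj]
      · rw [if_neg hj, Pi.single_eq_of_ne, map_zero]
        exact fun h => hj (Fin.succAbove_right_injective h)
    rw [Derivation.leibniz, pderivFrac_algebraMap, MvPolynomial.pderiv_X_of_ne
      (Fin.succAbove_ne s i).symm, map_zero, smul_zero, zero_add, smul_eq_mul, ← hδ] at h2
    rw [eq_div_of_mul_eq (X_ne_zero' s) ((mul_comm _ _).trans h2)]
    split_ifs <;> simp
  have h3 := congrArg δ.liftKaehlerDifferential hc
  rw [map_sum, map_zero] at h3
  simp only [map_smul, Derivation.liftKaehlerDifferential_comp_D, h1] at h3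
  simp only [smul_ite, smul_zero, Finset.sum_ite_eq', Finset.mem_univ, if_true] at h3
  rw [Algebra.smul_def] at h3
  exact (map_eq_zero _).mp ((mul_eq_zero.mp h3).resolve_right (inv_ne_zero (X_ne_zero' s)))

/-- The rational form `d(x₀/xₛ) ∧ … ∧ d(xₙ/xₛ)` (with the index `s` omitted). -/
def chartForm (s : Fin (n + 1)) :
    ⋀[(PSpace n).functionField]^n (Ω[(PSpace n).functionField⁄ℂ]) :=
  exteriorPower.ιMulti (PSpace n).functionField n fun j =>
    KaehlerDifferential.D ℂ (PSpace n).functionField (ratio (s.succAbove j) s)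

theorem ιMulti_ne_zero_of_linearIndependent {K V : Type*} [Field K] [AddCommGroup V] [Module K V]
    {n : ℕ} {v : Fin n → V} (hv : LinearIndependent K v) : exteriorPower.ιMulti K n v ≠ 0 := by
  have h := (exteriorPower.ιMulti_family_linearIndependent_field n hv).ne_zero
    (Set.powersetCard.ofFinEmbEquiv (RelEmbedding.refl _))
  rw [exteriorPower.ιMulti_family, Equiv.symm_apply_apply] at h
  exact h

theorem chartForm_ne_zero (s : Fin (n + 1)) : chartForm s ≠ 0 :=
  ιMulti_ne_zero_of_linearIndependent (linearIndependent_D_ratio s)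

end Chart

/-! ### Regular forms and the canonical divisor of `ℙⁿ` -/

section RegularForms

variable {n : ℕ}

theorem one_notMem (P : PSpace n) : (1 : CoordRing n) ∉ P.asHomogeneousIdeal.toIdeal :=
  fun h => (ProjectiveSpectrum.isPrime P).ne_top ((Ideal.eq_top_iff_one _).mpr h)

theorem const_mem_localRing (P : PSpace n) (c : ℂ) :
    algebraMap ℂ (PSpace n).functionField c ∈ localRing (RingHom.id (PSpace n).functionField) P :=
  (mem_localRing_iff P _).mpr ⟨0, MvPolynomial.C c, 1, MvPolynomial.isHomogeneous_C _ _,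
    MvPolynomial.isHomogeneous_one _ _, one_notMem P, by rw [toFrac_const, map_one, div_one]⟩

theorem ratio_mem_localRing {P : PSpace n} {s : Fin (n + 1)}
    (hs : (MvPolynomial.X s : CoordRing n) ∉ P.asHomogeneousIdeal.toIdeal) (i : Fin (n + 1)) :
    ratio i s ∈ localRing (RingHom.id (PSpace n).functionField) P :=
  (mem_localRing_iff P _).mpr ⟨1, _, _, MvPolynomial.isHomogeneous_X _ _,
    MvPolynomial.isHomogeneous_X _ _, hs, toFrac_ratio i s⟩

/-- Substituting `xᵢ / xₛ` for `xᵢ` amounts to setting `T = 1 / xₛ` in `scaleVars`, and a form of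
degree `N` becomes a multiple of `T ^ N` there. -/
theorem toFrac_aeval_ratio (s : Fin (n + 1)) {p : CoordRing n} {N : ℕ} (hp : p.IsHomogeneous N) :
    toFrac n (MvPolynomial.aeval (fun i => ratio i s) p) = algebraMap _ (CoordField n) p /
      algebraMap (CoordRing n) (CoordField n) (MvPolynomial.X s) ^ N := by
  set c : CoordField n := (algebraMap (CoordRing n) (CoordField n) (MvPolynomial.X s))⁻¹ with hc
  have h : (toFracAlgHom n).comp (MvPolynomial.aeval fun i => ratio i s) =
      ((Polynomial.aeval (R := CoordRing n) c).restrictScalars ℂ).comp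
        (scaleVars (Fin (n + 1))) := by
    refine MvPolynomial.algHom_ext fun i => ?_
    rw [AlgHom.comp_apply, AlgHom.comp_apply, MvPolynomial.aeval_X, scaleVars,
      MvPolynomial.aeval_X, toFracAlgHom_apply, toFrac_ratio]
    simp [hc, div_eq_mul_inv]
  have h1 := DFunLike.congr_fun h p
  rw [AlgHom.comp_apply, AlgHom.comp_apply, scaleVars_of_isHomogeneous hp] at h1
  refine h1.trans ?_
  rw [AlgHom.restrictScalars_apply, Polynomial.aeval_monomial, hc, inv_pow, div_eq_mul_inv]

/-- The span of the coordinate differentials over the local ring. -/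
def chartSpan (P : PSpace n) (s : Fin (n + 1)) :
    Submodule (localRing (RingHom.id (PSpace n).functionField) P)
      (Ω[(PSpace n).functionField⁄ℂ]) :=
  Submodule.span _ (Set.range fun j : Fin n =>
    KaehlerDifferential.D ℂ (PSpace n).functionField (ratio (s.succAbove j) s))

theorem smul_mem_chartSpan {P : PSpace n} {s : Fin (n + 1)} {g : (PSpace n).functionField}
    (hg : g ∈ localRing (RingHom.id (PSpace n).functionField) P)
    {x : Ω[(PSpace n).functionField⁄ℂ]} (hx : x ∈ chartSpan P s) : g • x ∈ chartSpan P s :=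
  Submodule.smul_mem _ (⟨g, hg⟩ : localRing (RingHom.id (PSpace n).functionField) P) hx

theorem D_ratio_mem_chartSpan (P : PSpace n) (s i : Fin (n + 1)) :
    KaehlerDifferential.D ℂ (PSpace n).functionField (ratio i s) ∈ chartSpan P s := by
  by_cases h : i = s
  · rw [h, ratio_self, Derivation.map_one_eq_zero]
    exact Submodule.zero_mem _
  · obtain ⟨j, rfl⟩ := Fin.exists_succAbove_eq h
    exact Submodule.subset_span ⟨j, rfl⟩

theorem aeval_ratio_mem {P : PSpace n} {s : Fin (n + 1)}
    (hs : (MvPolynomial.X s : CoordRing n) ∉ P.asHomogeneousIdeal.toIdeal) (p : CoordRing n) :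
    MvPolynomial.aeval (fun i => ratio i s) p ∈
        localRing (RingHom.id (PSpace n).functionField) P ∧
      KaehlerDifferential.D ℂ (PSpace n).functionField
        (MvPolynomial.aeval (fun i => ratio i s) p) ∈ chartSpan P s := by
  induction p using MvPolynomial.induction_on with
  | C c =>
    rw [MvPolynomial.aeval_C, Derivation.map_algebraMap]
    exact ⟨const_mem_localRing P c, Submodule.zero_mem _⟩
  | add p q hp hq =>
    rw [map_add, map_add]
    exact ⟨add_mem hp.1 hq.1, add_mem hp.2 hq.2⟩
  | mul_X p i hp =>
    rw [map_mul, MvPolynomial.aeval_X, Derivation.leibniz]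
    exact ⟨mul_mem hp.1 (ratio_mem_localRing hs i), add_mem
      (smul_mem_chartSpan hp.1 (D_ratio_mem_chartSpan P s i))
      (smul_mem_chartSpan (ratio_mem_localRing hs i) hp.2)⟩

/-- Dehomogenizing numerator and denominator gives `b = α / γ`, with `α`, `γ` polynomials in the
chart coordinates and `γ` a unit at `P`; the product rule for `b * γ = α` is then solved for `d b`.
-/
theorem D_mem_chartSpan {P : PSpace n} {s : Fin (n + 1)}
    (hs : (MvPolynomial.X s : CoordRing n) ∉ P.asHomogeneousIdeal.toIdeal)
    {b : (PSpace n).functionField}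
    (hb : b ∈ localRing (RingHom.id (PSpace n).functionField) P) :
    KaehlerDifferential.D ℂ (PSpace n).functionField b ∈ chartSpan P s := by
  obtain ⟨N, a, q, ha, hq, hqP, hab⟩ := (mem_localRing_iff P b).mp hb
  have hq0 := algebraMap_coordField_ne_zero (ne_zero_of_notMem hqP)
  have hX := X_ne_zero' s
  set α := MvPolynomial.aeval (fun i => ratio i s) a with hα
  set γ := MvPolynomial.aeval (fun i => ratio i s) q with hγ
  have hγ' : toFrac n γ = _ := toFrac_aeval_ratio s hq
  have hγ0 : γ ≠ 0 := by
    intro h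
    rw [h, map_zero] at hγ'
    exact div_ne_zero hq0 (pow_ne_zero _ hX) hγ'.symm
  have h1 : b * γ = α := by
    apply toFrac_injective
    rw [map_mul, hab, hγ', hα, toFrac_aeval_ratio s ha]
    field_simp
  have hinv : γ⁻¹ ∈ localRing (RingHom.id (PSpace n).functionField) P := by
    refine (mem_localRing_iff P _).mpr ⟨N, MvPolynomial.X s ^ N, q, ?_, hq, hqP, ?_⟩
    · simpa using (MvPolynomial.isHomogeneous_X ℂ s).pow N
    · rw [map_inv₀, hγ', inv_div, map_pow]
  have h2 := congrArg (KaehlerDifferential.D ℂ (PSpace n).functionField) h1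
  rw [Derivation.leibniz] at h2
  have h3 : KaehlerDifferential.D ℂ (PSpace n).functionField b =
      γ⁻¹ • (KaehlerDifferential.D ℂ (PSpace n).functionField α -
        b • KaehlerDifferential.D ℂ (PSpace n).functionField γ) := by
    rw [← h2, add_sub_cancel_left, smul_smul, inv_mul_cancel₀ hγ0, one_smul]
  rw [h3]
  exact smul_mem_chartSpan hinv (sub_mem (aeval_ratio_mem hs a).2
    (smul_mem_chartSpan hb (aeval_ratio_mem hs q).2))

/-- A wedge of differentials of regular functions is a determinant over the local ring times the
coordinate form, so that form alone generates. -/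
theorem mem_regularForms_iff {P : PSpace n} {s : Fin (n + 1)}
    (hs : (MvPolynomial.X s : CoordRing n) ∉ P.asHomogeneousIdeal.toIdeal)
    (η : ⋀[(PSpace n).functionField]^n (Ω[(PSpace n).functionField⁄ℂ])) :
    η ∈ regularForms (RingHom.id (PSpace n).functionField) n P ↔
      ∃ r ∈ localRing (RingHom.id (PSpace n).functionField) P, η = r • chartForm s := by
  constructor
  · intro h
    suffices hle : regularForms (RingHom.id (PSpace n).functionField) n P ≤
        Submodule.span (localRing (RingHom.id (PSpace n).functionField) P) {chartForm s} by
      obtain ⟨r, hr⟩ := Submodule.mem_span_singleton.mp (hle h)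
      exact ⟨r, r.2, hr.symm⟩
    rw [regularForms, Submodule.span_le]
    rintro _ ⟨b, rfl⟩
    have h1 := fun i => (Submodule.mem_span_range_iff_exists_fun _).mp
      (D_mem_chartSpan hs (b i).2)
    choose A hA using h1
    have h2 : (exteriorPower.ιMulti (PSpace n).functionField n fun i =>
        KaehlerDifferential.D ℂ (PSpace n).functionField (b i)) =
        (Matrix.of fun i j => (A i j : (PSpace n).functionField)).det • chartForm s :=
      (congrArg _ (funext fun i => (hA i).symm)).trans (alternatingMap_sum_smul
        (exteriorPower.ιMulti (PSpace n).functionField n) _ _)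
    have h3 : (Matrix.of fun i j => (A i j : (PSpace n).functionField)).det =
        ((Matrix.det (Matrix.of A) : localRing (RingHom.id (PSpace n).functionField) P) :
          (PSpace n).functionField) :=
      ((localRing (RingHom.id (PSpace n).functionField) P).subtype.map_det (Matrix.of A)).symm
    simp only [SetLike.mem_coe]
    rw [h2, h3]
    exact Submodule.smul_mem _ _ (Submodule.mem_span_singleton_self _)
  · rintro ⟨r, hr, rfl⟩
    exact Submodule.smul_mem _ (⟨r, hr⟩ : localRing (RingHom.id (PSpace n).functionField) P)
      (Submodule.subset_span ⟨fun j => ⟨_, ratio_mem_localRing hs (s.succAbove j)⟩, rfl⟩)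

variable (hn : 0 < n) {G : CoordRing n} (hG : Irreducible G) {e : ℕ} (he : G.IsHomogeneous e)

theorem ord_nonneg_of_mem_localRing {r : (PSpace n).functionField} (hr0 : r ≠ 0)
    (hr : r ∈ localRing (RingHom.id (PSpace n).functionField) (primePoint hn hG he)) :
    0 ≤ Scheme.ord r (primePoint hn hG he) := by
  obtain ⟨N, a, b, ha, hb, hbP, hab⟩ := (mem_localRing_iff _ r).mp hr
  have ha0 : a ≠ 0 := by
    rintro rfl
    rw [map_zero, zero_div] at hab
    exact hr0 ((map_eq_zero _).mp hab)
  rw [ord_primePoint hn hG he ha hb ha0 (ne_zero_of_notMem hbP) hab,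
    multiplicity_eq_zero.mpr (fun h => hbP ((mem_primePoint hn hG he).mpr h))]
  simp

/-- The supremum is a maximum attained at `g = h`: any other representation gives `h = g * r` with
`r` regular at the point, hence `ord g ≤ ord h`. -/
theorem canonicalDivisor_smul_chartForm {s : Fin (n + 1)}
    (hs : (MvPolynomial.X s : CoordRing n) ∉ (primePoint hn hG he).asHomogeneousIdeal.toIdeal)
    {h : (PSpace n).functionField} (hh : h ≠ 0) :
    canonicalDivisor (RingHom.id (PSpace n).functionField) n (h • chartForm s)
      (primePoint hn hG he) = Scheme.ord h (primePoint hn hG he) := by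
  refine IsGreatest.csSup_eq ⟨⟨h, hh, rfl, chartForm s,
    (mem_regularForms_iff hs _).mpr ⟨1, one_mem _, (one_smul _ _).symm⟩, rfl⟩, ?_⟩
  rintro _ ⟨g, hg, rfl, η, hη, hω⟩
  obtain ⟨r, hr, rfl⟩ := (mem_regularForms_iff hs _).mp hη
  rw [smul_smul] at hω
  have h1 : h = g * r := smul_left_injective _ (chartForm_ne_zero s) hω
  have hr0 : r ≠ 0 := by
    rintro rfl
    exact hh (by rw [h1, mul_zero])
  rw [h1, Scheme.ord_mul hg hr0, RingHom.id_apply]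
  have := ord_nonneg_of_mem_localRing hn hG he hr0 hr
  omega

end RegularForms

/-- The change of coordinates from the chart `x₁ ≠ 0` to the chart `x₀ ≠ 0`. Its Jacobian explains
the degree `-(n + 1)` of the canonical divisor, with `n = m + 1`. -/
theorem chartForm_zero_eq (m : ℕ) :
    chartForm (0 : Fin (m + 1 + 1)) = (-(ratio (n := m + 1) 1 0) ^ (m + 2)) • chartForm (n := m + 1) 1 := by
  set w : (PSpace (m + 1)).functionField := ratio 1 0 with hw
  let D := KaehlerDifferential.D ℂ (PSpace (m + 1)).functionField
  have hw0 : w ≠ 0 := ratio_ne_zero 1 0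
  have h1 : D w = (-w ^ 2) • D (ratio 0 1) := by
    have h2 : ratio 0 1 * w = 1 := (ratio_mul_ratio 0 1 0).trans (ratio_self 0)
    have h3 := congrArg D h2
    rw [Derivation.leibniz, Derivation.map_one_eq_zero] at h3
    have h4 := congrArg (fun x => w • x) h3
    simp only [smul_add, smul_smul, smul_zero] at h4
    rw [mul_comm w, h2, one_smul, ← pow_two] at h4
    rw [neg_smul]
    exact eq_neg_of_add_eq_zero_left h4
  -- From `dw = -w² d(x₀/x₁)` and `xᵢ/x₀ = (xᵢ/x₁) w`, the Jacobian is lower triangular with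
  -- diagonal `-w², w, …, w`.
  let A : Matrix (Fin (m + 1)) (Fin (m + 1)) (PSpace (m + 1)).functionField :=
    Matrix.of fun i j => Fin.cases (motive := fun _ => (PSpace (m + 1)).functionField)
      (Fin.cases (motive := fun _ => (PSpace (m + 1)).functionField) (-w ^ 2)
        (fun i' => ratio i'.succ.succ 1 * (-w ^ 2)) i)
      (fun j' => if i = j'.succ then w else 0) j
  have hA : A.det = -w ^ (m + 2) := by
    have hlow : A.IsLowerTriangular := by
      intro i j hij
      have hij' : i < j := hij
      induction j using Fin.cases with
      | zero => exact absurd hij' (Fin.not_lt_zero i)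
      | succ j => exact if_neg hij'.ne
    rw [Matrix.det_of_isLowerTriangular A hlow, Fin.prod_univ_succ]
    have h2 : ∀ i : Fin m, A i.succ i.succ = w := fun i => if_pos rfl
    have h3 : A 0 0 = -w ^ 2 := rfl
    simp only [h2, h3, Finset.prod_const, Finset.card_univ, Fintype.card_fin]
    ring
  have h5 : ∀ i : Fin (m + 1), D (ratio ((0 : Fin (m + 2)).succAbove i) 0) =
      ∑ j, A i j • D (ratio ((1 : Fin (m + 2)).succAbove j) 1) := by
    intro i
    rw [Fin.sum_univ_succ]
    induction i using Fin.cases with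
    | zero =>
      have h2 : ∀ j : Fin m, A 0 j.succ = 0 := fun j =>
        if_neg (t := w) (Fin.succ_ne_zero j).symm
      have h3 : A 0 0 = -w ^ 2 := rfl
      simp only [h2, zero_smul, Finset.sum_const_zero, add_zero, h3]
      exact h1
    | succ i =>
      have h2 : ∀ j : Fin m, A i.succ j.succ = if i = j then w else 0 := fun j =>
        if_congr Fin.succ_inj rfl rfl
      have h3 : A i.succ 0 = ratio i.succ.succ 1 * (-w ^ 2) := rfl
      have h4 : D (ratio i.succ.succ 0) = ratio i.succ.succ 1 • D w + w • D (ratio i.succ.succ 1) := by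
        rw [← Derivation.leibniz, hw, ratio_mul_ratio]
      simp only [h2, h3, ite_smul, zero_smul, Finset.sum_ite_eq, Finset.mem_univ, if_true]
      refine h4.trans ?_
      rw [h1, smul_smul]
      rfl
  rw [← hA]
  exact (congrArg _ (funext h5)).trans (alternatingMap_sum_smul
    (exteriorPower.ιMulti (PSpace (m + 1)).functionField (m + 1)) _ _)

theorem not_dvd_X_of_dvd_X {n : ℕ} {G : CoordRing n} (hG : Irreducible G) {i j : Fin (n + 1)}
    (hij : i ≠ j) (hi : G ∣ MvPolynomial.X i) : ¬ G ∣ MvPolynomial.X j := by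
  intro hj
  have h := fun {l : Fin (n + 1)} => (hG.dvd_irreducible_iff_associated
    (MvPolynomial.X_prime (R := ℂ) (i := l)).irreducible).mp
  exact hij (MvPolynomial.X_dvd_X.mp ((h hi).symm.trans (h hj)).dvd)

/-- Where `x₀ ≠ 0` the form is a local generator. Along `x₀ = 0` the variable `x₁` does not vanish
identically, and `chartForm_zero_eq` gives order `-(n + 1)` there. -/
theorem canonicalDivisor_chartForm_zero {n : ℕ} (hn : 0 < n) {G : CoordRing n} (hG : Irreducible G)
    {e : ℕ} (he : G.IsHomogeneous e) :
    canonicalDivisor (RingHom.id (PSpace n).functionField) n (chartForm 0)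
      (primePoint hn hG he) = -((n : ℤ) + 1) * multiplicity G (MvPolynomial.X 0) := by
  by_cases h0 : (MvPolynomial.X 0 : CoordRing n) ∈
      (primePoint hn hG he).asHomogeneousIdeal.toIdeal
  · obtain ⟨m, rfl⟩ : ∃ m, n = m + 1 := ⟨n - 1, by omega⟩
    have h1 : (MvPolynomial.X 1 : CoordRing (m + 1)) ∉
        (primePoint hn hG he).asHomogeneousIdeal.toIdeal := by
      rw [mem_primePoint] at h0 ⊢
      exact not_dvd_X_of_dvd_X hG zero_ne_one h0
    have hX : ∀ i : Fin (m + 1 + 1),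
        (MvPolynomial.X i ^ (m + 2) : CoordRing (m + 1)).IsHomogeneous (m + 2) := fun i => by
      simpa using (MvPolynomial.isHomogeneous_X ℂ i).pow (m + 2)
    rw [chartForm_zero_eq, canonicalDivisor_smul_chartForm hn hG he h1
      (neg_ne_zero.mpr (pow_ne_zero _ (ratio_ne_zero 1 0))),
      ord_primePoint hn hG he (hX 1).neg (hX 0)
        (neg_ne_zero.mpr (pow_ne_zero _ (MvPolynomial.X_ne_zero 1)))
        (pow_ne_zero _ (MvPolynomial.X_ne_zero 0))
        (by rw [map_neg, map_pow, toFrac_ratio, map_neg, map_pow, map_pow, div_pow]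
            exact (neg_div _ _).symm),
      (finiteMultiplicity_of_irreducible hG (MvPolynomial.X_ne_zero 0)).multiplicity_pow hG.prime,
      multiplicity_neg, multiplicity_eq_zero.mpr fun h =>
        h1 ((mem_primePoint hn hG he).mpr (hG.prime.dvd_of_dvd_pow h))]
    push_cast
    ring
  · rw [← one_smul (PSpace n).functionField (chartForm 0),
      canonicalDivisor_smul_chartForm hn hG he h0 one_ne_zero, multiplicity_eq_zero.mpr
        (fun h => h0 ((mem_primePoint hn hG he).mpr h))]
    rw [ord_primePoint hn hG he (MvPolynomial.isHomogeneous_one _ _)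
      (MvPolynomial.isHomogeneous_one _ _) one_ne_zero one_ne_zero (by simp)]
    simp

/-! ### Prime divisors on a normal variety -/

section IdModel

variable {X : Scheme.{0}} [IsIntegral X]
  (hX : ∀ x : X, IsIntegrallyClosed (X.presheaf.stalk x))

/-- A normal variety as a model of itself. -/
def idModel : BirationalModel X where
  Y := X
  f := 𝟙 X
  isIntegral := inferInstance
  isProper := inferInstance
  isNormal := hX
  map_genericPoint := rfl
  isIso_stalkMap := inferInstance

theorem pullback_idModel : (idModel hX).pullback = RingHom.id X.functionField := by
  have h : (idModel hX).pullback = ((X.presheaf.stalkCongr (.of_eq rfl)).hom ≫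
    (𝟙 X : X ⟶ X).stalkMap (genericPoint X)).hom := rfl
  rw [h]
  have h2 : (X.presheaf.stalkCongr (.of_eq (rfl : genericPoint X = genericPoint X))).hom = 𝟙 _ :=
    TopCat.Presheaf.stalkSpecializes_refl _ _
  simp [h2]
  rfl

/-- A prime divisor on a normal variety as a prime divisor over it. -/
def primeDivisorOn {P : X} (hP : coheight P = 1) : PrimeDivisorOver X where
  toBirationalModel := idModel hX
  E := P
  codim_one := hP

variable [IsLocallyNoetherian X]

/-- The chosen local equation is arbitrary, but `P` specializes to itself, so its order at `P` is
forced to be `m * D P`. -/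
theorem pullbackDivisor_idModel {D : X → ℚ} (hD : IsQCartier D) {P : X} (hP : coheight P = 1) :
    pullbackDivisor (idModel hX) D P = D P := by
  have h : ∃ q : ℕ × X.functionField, IsLocalEquation D ((idModel hX).f P) q.1 q.2 := by
    obtain ⟨m, g, h⟩ := hD P
    exact ⟨(m, g), h⟩
  refine (dif_pos h).trans ?_
  rw [pullback_idModel]
  obtain ⟨h1, -, h3⟩ := h.choose_spec
  have h4 := h3 P hP (specializes_refl P)
  change (Scheme.ord h.choose.2 P : ℚ) / _ = _
  rw [h4, mul_div_cancel_left₀ _ (by exact_mod_cast h1.ne')]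

variable [X.Over (Spec (.of ℂ))]

theorem logDiscrepancy_primeDivisorOn {n : ℕ}
    {ω : ⋀[X.functionField]^n (Ω[X.functionField⁄ℂ])} {Δ : X → ℚ}
    (hD : IsQCartier (logCanonical n ω Δ)) {P : X} (hP : coheight P = 1) :
    logDiscrepancy n ω Δ (primeDivisorOn hX hP) = 1 - Δ P := by
  have h1 : canonicalDivisor (primeDivisorOn hX hP).pullback n ω (primeDivisorOn hX hP).E =
      canonicalDivisor (RingHom.id X.functionField) n ω P := by
    change canonicalDivisor (idModel hX).pullback n ω P = _
    rw [pullback_idModel]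
    rfl
  have h2 : pullbackDivisor (primeDivisorOn hX hP).toBirationalModel (logCanonical n ω Δ)
      (primeDivisorOn hX hP).E = logCanonical n ω Δ P := pullbackDivisor_idModel hX hD hP
  rw [logDiscrepancy, h1, h2, logCanonical]
  ring

open Classical in
theorem expectedVanishing_primeDivisorOn {n : ℕ}
    {ω : ⋀[X.functionField]^n (Ω[X.functionField⁄ℂ])} {Δ : X → ℚ} {P : X} (hP : coheight P = 1) :
    expectedVanishing n ω Δ (primeDivisorOn hX hP) =
      (1 / vol (RingHom.id X.functionField) n fun Q : X => -(logCanonical n ω Δ Q : ℝ)) *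
        ∫ t in Set.Ioi (0 : ℝ), vol (RingHom.id X.functionField) n fun Q : X =>
          -(pullbackDivisor (idModel hX) (logCanonical n ω Δ) Q : ℝ) -
            t * (if Q = P then 1 else 0) := by
  rw [expectedVanishing]
  have h : (primeDivisorOn hX hP).pullback = RingHom.id X.functionField := pullback_idModel hX
  rw [h]
  rfl

end IdModel

/-! ### Log discrepancy and expected vanishing of hypersurfaces -/

section Projective

variable {n : ℕ}

theorem divisor_primePoint {d : ℕ} (S : Hypersurface n d) (hn : 0 < n) {G : CoordRing n}
    (hG : Irreducible G) {e : ℕ} (he : G.IsHomogeneous e) :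
    S.divisor (primePoint hn hG he) = multiplicity G S.eqn := by
  have h := exists_X_notMem (primePoint hn hG he)
  rw [Hypersurface.divisor, dif_pos h]
  exact ord_localForm hn hG he h.choose_spec S.isHomogeneous S.ne_zero

theorem multiplicity_of_irreducible {G H : CoordRing n} (hG : Irreducible G) (hH : Irreducible H)
    [Decidable (Associated H G)] : multiplicity H G = if Associated H G then 1 else 0 := by
  split_ifs with h
  · rw [multiplicity_eq_of_associated_right h.symm, multiplicity_self]
  · exact multiplicity_eq_zero.mpr fun h1 => h ((hH.dvd_irreducible_iff_associated hG).mp h1)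

theorem isUnit_of_isHomogeneous_zero {c : CoordRing n} (hc : c.IsHomogeneous 0) (h0 : c ≠ 0) :
    IsUnit c := by
  rw [MvPolynomial.totalDegree_eq_zero_iff_eq_C.mp
    ((MvPolynomial.totalDegree_zero_iff_isHomogeneous _).mpr hc)] at h0 ⊢
  exact (IsUnit.mk0 _ fun h => h0 (by rw [h, map_zero])).map _

theorem degree_pos_of_irreducible {G : CoordRing n} (hG : Irreducible G) {e : ℕ}
    (he : G.IsHomogeneous e) : 0 < e := by
  rcases Nat.eq_zero_or_pos e with rfl | h
  · exact absurd (isUnit_of_isHomogeneous_zero he hG.ne_zero) hG.not_isUnit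
  · exact h

variable {k : ℕ} {d : Fin k → ℕ}

/-- With `r` the degree of `-(K + Δ)`, the volumes are `rⁿ` and `max(r - t e, 0)ⁿ`, and the integral
of the latter is `r ^ (n + 1) / (e (n + 1))`. -/
theorem expectedVanishing_primePoint (hn : 0 < n)
    (hX : ∀ x : PSpace n, IsIntegrallyClosed ((PSpace n).presheaf.stalk x))
    (S : ∀ j, Hypersurface n (d j)) (a : Fin k → ℚ)
    (hQ : IsQCartier (logCanonical n (chartForm 0)
      fun P : PSpace n => ∑ j, a j * ((S j).divisor P : ℚ)))
    (hr : 0 < (n : ℝ) + 1 - ∑ j, (a j : ℝ) * d j)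
    {G : CoordRing n} (hG : Irreducible G) {e : ℕ} (he : G.IsHomogeneous e) :
    expectedVanishing n (chartForm 0) (fun P : PSpace n => ∑ j, a j * ((S j).divisor P : ℚ))
      (primeDivisorOn hX (coheight_primePoint hn hG he)) =
      ((n : ℝ) + 1 - ∑ j, (a j : ℝ) * d j) / (e * (n + 1)) := by
  classical
  set r : ℝ := (n : ℝ) + 1 - ∑ j, (a j : ℝ) * d j with hrdef
  have hepos : (0 : ℝ) < e := Nat.cast_pos.mpr (degree_pos_of_irreducible hG he)
  -- The divisor `-(K + Δ) - t E` is the combination of the divisors of `x₀`, `G` and the `Fⱼ` with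
  -- coefficients `n + 1`, `-t` and `-aⱼ`; the two added indices stand for `x₀` and `G`.
  let f : Option (Option (Fin k)) → CoordRing n := fun l =>
    l.elim (MvPolynomial.X 0) fun l => l.elim G fun j => (S j).eqn
  let δ : Option (Option (Fin k)) → ℕ := fun l => l.elim 1 fun l => l.elim e d
  have hf : ∀ l, (f l).IsHomogeneous (δ l) := by
    rintro (_ | _ | j)
    · exact MvPolynomial.isHomogeneous_X ℂ 0
    · exact he
    · exact (S j).isHomogeneous
  have hf0 : ∀ l, f l ≠ 0 := by
    rintro (_ | _ | j)
    · exact MvPolynomial.X_ne_zero 0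
    · exact hG.ne_zero
    · exact (S j).ne_zero
  let c : ℝ → Option (Option (Fin k)) → ℝ := fun t l =>
    l.elim ((n : ℝ) + 1) fun l => l.elim (-t) fun j => -(a j : ℝ)
  have hc : ∀ t, ∑ l, c t l * δ l = r - t * e := by
    intro t
    simp only [Fintype.sum_option, c, δ, Option.elim, hrdef, neg_mul, Finset.sum_neg_distrib,
      Nat.cast_one]
    ring
  have hlog : ∀ (H : CoordRing n) (e' : ℕ) (hH : Irreducible H) (he' : H.IsHomogeneous e'),
      (logCanonical n (chartForm 0) (fun P : PSpace n => ∑ j, a j * ((S j).divisor P : ℚ))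
        (primePoint hn hH he') : ℝ) = -((n : ℝ) + 1) * multiplicity H (MvPolynomial.X 0) +
        ∑ j, (a j : ℝ) * multiplicity H (S j).eqn := by
    intro H e' hH he'
    rw [logCanonical, canonicalDivisor_chartForm_zero]
    simp only [divisor_primePoint]
    push_cast
    rfl
  have hE : ∀ (H : CoordRing n) (e' : ℕ) (hH : Irreducible H) (he' : H.IsHomogeneous e'),
      (if primePoint hn hH he' = primePoint hn hG he then (1 : ℝ) else 0) = multiplicity H G := by
    intro H e' hH he'
    rw [multiplicity_of_irreducible hG hH]
    simp only [primePoint_eq_iff]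
    split_ifs <;> simp
  have hvol : ∀ t, vol (RingHom.id (PSpace n).functionField) n (fun Q : PSpace n =>
      -(pullbackDivisor (idModel hX) (logCanonical n (chartForm 0)
        fun P : PSpace n => ∑ j, a j * ((S j).divisor P : ℚ)) Q : ℝ) -
          t * (if Q = primePoint hn hG he then 1 else 0)) = max (r - t * e) 0 ^ n := by
    intro t
    rw [← hc t]
    refine vol_eq hn hf hf0 fun H e' hH he' => ?_
    rw [pullbackDivisor_idModel hX hQ (coheight_primePoint hn hH he'), hlog, hE]
    simp only [Fintype.sum_option, c, f, Option.elim, neg_mul, Finset.sum_neg_distrib]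
    ring
  have hvol0 : vol (RingHom.id (PSpace n).functionField) n (fun Q : PSpace n =>
      -(logCanonical n (chartForm 0)
        (fun P : PSpace n => ∑ j, a j * ((S j).divisor P : ℚ)) Q : ℝ)) = r ^ n := by
    have h1 : max (∑ l, c 0 l * δ l) 0 ^ n = r ^ n := by
      rw [hc, zero_mul, sub_zero, max_eq_left hr.le]
    rw [← h1]
    refine vol_eq hn hf hf0 fun H e' hH he' => ?_
    rw [hlog]
    simp only [Fintype.sum_option, c, f, Option.elim, neg_mul, Finset.sum_neg_distrib]
    ring
  rw [expectedVanishing_primeDivisorOn, hvol0]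
  have h2 : (fun t : ℝ => vol (RingHom.id (PSpace n).functionField) n (fun Q : PSpace n =>
      -(pullbackDivisor (idModel hX) (logCanonical n (chartForm 0)
        fun P : PSpace n => ∑ j, a j * ((S j).divisor P : ℚ)) Q : ℝ) -
          t * (if Q = primePoint hn hG he then 1 else 0))) = fun t => max (r - t * e) 0 ^ n :=
    funext hvol
  rw [h2]
  obtain ⟨m, rfl⟩ : ∃ m, n = m + 1 := ⟨n - 1, by omega⟩
  rw [integral_max_sub_mul_pow m hr hepos]
  push_cast
  have : (m : ℝ) + 2 ≠ 0 := by positivity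
  rw [show (m : ℝ) + 1 + 1 = m + 2 by ring]
  field_simp
  ring

/-- On a K-semistable pair, a prime divisor `{G = 0}` of degree `e` has `S ≤ A`. -/
theorem sum_mul_multiplicity_le (hn : 0 < n) (S : ∀ j, Hypersurface n (d j)) (a : Fin k → ℚ)
    (hr : 0 < (n : ℝ) + 1 - ∑ j, (a j : ℝ) * d j)
    (hK : IsKSemistableLogFano n (fun P : PSpace n => ∑ j, a j * ((S j).divisor P : ℚ)))
    {G : CoordRing n} (hG : Irreducible G) {e : ℕ} (he : G.IsHomogeneous e) :
    ∑ j, (a j : ℝ) * multiplicity G (S j).eqn ≤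
      1 - ((n : ℝ) + 1 - ∑ j, (a j : ℝ) * d j) / (e * (n + 1)) := by
  have hQ := hK.isQCartier _ (chartForm_ne_zero 0)
  have h := hK.beta_nonneg _ (chartForm_ne_zero 0)
    (primeDivisorOn hK.isNormal (coheight_primePoint hn hG he))
  rw [beta, expectedVanishing_primePoint hn hK.isNormal S a hQ hr hG he,
    logDiscrepancy_primeDivisorOn hK.isNormal hQ] at h
  simp only [divisor_primePoint] at h
  push_cast at h
  linarith

end Projective

/-! ### Arithmetic of the coefficients -/

section Coefficients

/-- The number `s` with `a_j = 1 - s / d_j`. -/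
def slope (n : ℕ) {k : ℕ} (d : Fin k → ℕ) : ℚ := ((n : ℚ) + 1 - ∑ i, (d i : ℚ)) / ((n : ℚ) - k + 1)

variable {n k : ℕ} {d : Fin k → ℕ} (hd : ∀ j, 0 < d j) (hsum : ∑ j, d j < n + 1)

include hd hsum in
theorem codim_pos : 0 < (n : ℚ) - k + 1 := by
  have h1 : k ≤ ∑ j, d j := by
    simpa using Finset.sum_le_sum fun j (_ : j ∈ Finset.univ) => Nat.succ_le_of_lt (hd j)
  have h2 : (k : ℚ) < n + 1 := by exact_mod_cast h1.trans_lt hsum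
  linarith

include hd hsum in
theorem slope_pos : 0 < slope n d := by
  refine div_pos ?_ (codim_pos hd hsum)
  have : (∑ j, (d j : ℚ)) < n + 1 := by exact_mod_cast hsum
  linarith

include hd hsum in
-- The inequality amounts to `k < ∑ dⱼ`, which holds because all degrees are at least 1 and one is
-- larger.
theorem slope_lt_one (hne : ∃ j, d j ≠ 1) : slope n d < 1 := by
  rw [slope, div_lt_one (codim_pos hd hsum)]
  obtain ⟨j, hj⟩ := hne
  have h1 : ∑ _j : Fin k, 1 < ∑ j, d j := Finset.sum_lt_sum
    (fun j _ => Nat.succ_le_of_lt (hd j)) ⟨j, Finset.mem_univ j, by have := hd j; omega⟩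
  have h2 : (k : ℚ) < ∑ j, (d j : ℚ) := by
    simp only [Finset.sum_const, Finset.card_univ, Fintype.card_fin, smul_eq_mul, mul_one] at h1
    exact_mod_cast h1
  linarith

include hd hsum in
theorem coeff_eq (j : Fin k) : coeff n d j = 1 - slope n d / d j := by
  have h1 := (codim_pos hd hsum).ne'
  have h2 : (d j : ℚ) ≠ 0 := Nat.cast_ne_zero.mpr (hd j).ne'
  rw [coeff, slope]
  field_simp
  ring

include hd hsum in
theorem degree_eq_slope : (n : ℚ) + 1 - ∑ j, coeff n d j * d j = (n + 1) * slope n d := by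
  have h1 := (codim_pos hd hsum).ne'
  have h2 : ∀ j, coeff n d j * d j = d j - slope n d := by
    intro j
    have h2 : (d j : ℚ) ≠ 0 := Nat.cast_ne_zero.mpr (hd j).ne'
    rw [coeff_eq hd hsum]
    field_simp
  simp only [h2, Finset.sum_sub_distrib, Finset.sum_const, Finset.card_univ, Fintype.card_fin,
    nsmul_eq_mul]
  rw [slope]
  field_simp
  ring

include hd hsum in
theorem coeff_pos (hne : ∃ j, d j ≠ 1) (j : Fin k) : 0 < coeff n d j := by
  rw [coeff_eq hd hsum, sub_pos, div_lt_one (Nat.cast_pos.mpr (hd j))]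
  exact (slope_lt_one hd hsum hne).trans_le (by exact_mod_cast hd j)

include hd hsum in
-- The degree of `-(K + Δ)` is `(n + 1) s`, so the factor `n + 1` cancels in `S(E)` and leaves `s /
-- e`.
theorem sum_coeff_mul_multiplicity_le (hn : 0 < n) (S : ∀ j, Hypersurface n (d j))
    (hK : IsKSemistableLogFano n
      (fun P : PSpace n => ∑ j, coeff n d j * ((S j).divisor P : ℚ)))
    {G : CoordRing n} (hG : Irreducible G) {e : ℕ} (he : G.IsHomogeneous e) :
    ∑ j, coeff n d j * multiplicity G (S j).eqn ≤ 1 - slope n d / e := by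
  have h1 : (n : ℝ) + 1 - ∑ j, (coeff n d j : ℝ) * d j = (n + 1) * (slope n d : ℝ) := by
    exact_mod_cast congrArg (Rat.cast (K := ℝ)) (degree_eq_slope hd hsum)
  have hs : (0 : ℝ) < slope n d := by exact_mod_cast slope_pos hd hsum
  have h2 := sum_mul_multiplicity_le hn S (coeff n d) (by rw [h1]; positivity) hK hG he
  have he0 : (e : ℝ) ≠ 0 := Nat.cast_ne_zero.mpr (degree_pos_of_irreducible hG he).ne'
  have h3 : ((n : ℝ) + 1) * (slope n d : ℝ) / (e * (n + 1)) = slope n d / e := by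
    field_simp
  rw [h1, h3] at h2
  exact_mod_cast h2

end Coefficients

end KStab

end

/-! ### Irreducibility and distinctness -/

theorem mainTheorem4 (n k : ℕ) (hn : 0 < n) (d : Fin k → ℕ) (hd : ∀ j, 0 < d j)
    (hsum : ∑ j, d j < n + 1) (hne : ∃ j, d j ≠ 1) (S : ∀ j, KStab.Hypersurface n (d j))
    (hK : KStab.IsKSemistableLogFano n
      (fun P : KStab.PSpace n => ∑ j, KStab.coeff n d j * ((S j).divisor P : ℚ))) :
    (∀ j, Irreducible (S j).eqn) ∧ ∀ i j, i ≠ j → (S i).carrier ≠ (S j).carrier := by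
  have hapos := KStab.coeff_pos hd hsum hne
  have hspos := KStab.slope_pos hd hsum
  have hirr : ∀ j, Irreducible (S j).eqn := by
    intro j
    have hu : ¬ IsUnit (S j).eqn := by
      intro h
      have h1 := (MvPolynomial.isUnit_iff_totalDegree_of_isReduced.mp h).2
      rw [(S j).isHomogeneous.totalDegree (S j).ne_zero] at h1
      exact (hd j).ne' h1
    obtain ⟨G, hG, c, hc⟩ := WfDvdMonoid.exists_irreducible_factor hu (S j).ne_zero
    obtain ⟨e, e', hee, he, he'⟩ := KStab.exists_isHomogeneous_of_mul
      (hc ▸ (S j).isHomogeneous) (hc ▸ (S j).ne_zero)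
    have hle := KStab.sum_coeff_mul_multiplicity_le hd hsum hn S hK hG he
    -- Positivity of the coefficients allows all other terms of the sum to be dropped.
    have h1 : KStab.coeff n d j * multiplicity G (S j).eqn ≤
        ∑ i, KStab.coeff n d i * multiplicity G (S i).eqn :=
      Finset.single_le_sum (f := fun i => KStab.coeff n d i * (multiplicity G (S i).eqn : ℚ))
        (fun i _ => mul_nonneg (hapos i).le (Nat.cast_nonneg _)) (Finset.mem_univ j)
    have h2 : (1 : ℚ) ≤ multiplicity G (S j).eqn := by
      exact_mod_cast Nat.one_le_iff_ne_zero.mpr (multiplicity_ne_zero.mpr ⟨c, hc⟩)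
    have h3 : KStab.coeff n d j ≤ 1 - KStab.slope n d / e :=
      (le_mul_of_one_le_right (hapos j).le h2).trans (h1.trans hle)
    rw [KStab.coeff_eq hd hsum] at h3
    have hepos := KStab.degree_pos_of_irreducible hG he
    have h4 : d j ≤ e := by
      have h5 : KStab.slope n d / e ≤ KStab.slope n d / d j := by linarith
      rw [div_le_div_iff_of_pos_left hspos (Nat.cast_pos.mpr hepos)
        (Nat.cast_pos.mpr (hd j))] at h5
      exact_mod_cast h5
    -- The irreducible factor `G` already has the full degree `d j`, so the cofactor is a constant.
    obtain rfl : e' = 0 := by omega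
    have hcu := KStab.isUnit_of_isHomogeneous_zero he' (right_ne_zero_of_mul (hc ▸ (S j).ne_zero))
    rw [hc]
    exact (irreducible_mul_isUnit hcu).mpr hG
  refine ⟨hirr, fun i j hij hcar => ?_⟩
  -- Evaluating the equality of sets at the generic point of `S j` gives `Fⱼ ∣ Fᵢ`.
  have hmem : KStab.primePoint hn (hirr j) (S j).isHomogeneous ∈ (S j).carrier :=
    Set.singleton_subset_iff.mpr (Ideal.mem_span_singleton_self _)
  rw [← hcar] at hmem
  have hdvd : (S j).eqn ∣ (S i).eqn := Ideal.mem_span_singleton.mp (Set.singleton_subset_iff.mp hmem)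
  have hle := KStab.sum_coeff_mul_multiplicity_le hd hsum hn S hK (hirr j) (S j).isHomogeneous
  -- The terms `i` and `j` alone exceed the bound: the right-hand side `1 - s / dⱼ` equals `aⱼ`,
  -- leaving no room for `aᵢ > 0`.
  have h1 : KStab.coeff n d i * multiplicity (S j).eqn (S i).eqn +
      KStab.coeff n d j * multiplicity (S j).eqn (S j).eqn ≤
      ∑ l, KStab.coeff n d l * multiplicity (S j).eqn (S l).eqn := by
    rw [← Finset.sum_pair hij (f := fun l =>
      KStab.coeff n d l * (multiplicity (S j).eqn (S l).eqn : ℚ))]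
    exact Finset.sum_le_sum_of_subset_of_nonneg (Finset.subset_univ _) fun l _ _ =>
      mul_nonneg (hapos l).le (Nat.cast_nonneg _)
  have h2 : (1 : ℚ) ≤ multiplicity (S j).eqn (S i).eqn := by
    exact_mod_cast Nat.one_le_iff_ne_zero.mpr (multiplicity_ne_zero.mpr hdvd)
  have h3 := le_mul_of_one_le_right (hapos i).le h2
  rw [multiplicity_self, Nat.cast_one, mul_one] at h1
  have h4 := KStab.coeff_eq hd hsum j
  have := hapos i
  linarith
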